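/- Let $\epsilon\in[0,1]$. The dicode erasure channel (DEC) has inputs $x_t\in\{0,1\}$, state $s_{t-1}=x_{t-1}$, and output $y_t=x_t-x_{t-1}\in\{-1,0,1\}$ with probability $1-\epsilon$ and $y_t=\,?$ (erasure) with probability $\epsilon$, independently over time. The equation $p^\epsilon=2(1-p)$ has exactly one solution $p\in(0,1)$, and with this $p$ put $$B(\epsilon)=1+\epsilon\log_2\frac{1-p}{p}.$$ Then the following hold. (1) For each initial state $s_0\in\{0,1\}$, the capacity of the DEC without feedback (the supremum of the rates, in bits per channel use, achievable by block codes with vanishing average error probability when the channel starts in $s_0$) is at most $B(\epsilon)$. Likewise the limit $\lim_{n\to\infty}\max_{P(x^n)}\frac1n I(X^n;Y^n\mid S_0=s_0)$ exists, does not depend on $s_0$, and is at most $B(\epsilon)$. (2) $B(\epsilon)$ is the dual capacity bound of the following test distribution on a graph with nodes $1,2,3$. From every node, the edge labelled $-1$ leads to node $1$, the edge labelled $1$ leads to node $2$, the edge labelled $?$ leads to node $3$, and the edge labelled $0$ is a self-loop. The probabilities $R(y\mid q)$ of the labels $y=-1,0,1,?$ are $(0,\frac{1-\epsilon}2,\frac{1-\epsilon}2,\epsilon)$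 at $q=1$, $(\frac{1-\epsilon}2,\frac{1-\epsilon}2,0,\epsilon)$ at $q=2$, and $(\frac{p(1-\epsilon)}2,(1-p)(1-\epsilon),\frac{p(1-\epsilon)}2,\epsilon)$ at $q=3$. That is, for every initial node $q_0$ and initial state $s_0$ with $s_0=0$ if $q_0=1$ and $s_0=1$ if $q_0=2$, $$\lim_{n\to\infty}\max_{x^n\in\{0,1\}^n}\frac1n\sum_{t=1}^n\sum_{q,s}P(Q_{t-1}=q,S_{t-1}=s\mid x^{t-1},s_0,q_0)\,D\big(P(\cdot\mid x_t,s)\,\big\|\,R(\cdot\mid q)\big)=B(\epsilon),$$ where $Q_t$ is the node reached from $q_0$ along the edges labelled $y_1,\dots,y_t$, $P(\cdot\mid x,s)$ is the law of the output for input $x$ and previous state $s$, and $D$ is relative entropy in bits. (3) $B(\epsilon)$ equals the feedback capacity of the DEC: for each $s_0$, $\lim_{n\to\infty}\max\frac1n I(X^n\to Y^n\mid S_0=s_0)=B(\epsilon)$, where the maximum of the directed information is over all input laws $\prod_{t=1}^nP(x_t\mid x^{t-1},y^{t-1})$. -/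

import Mathlib

open Filter Topology
open scoped BigOperators

noncomputable section

/-- A finite-state channel with input alphabet `X`, output alphabet `Y` and state set `S`:
`kernel x s s' y` is the probability `P(s', y | x, s)` of moving to the state `s'` and producing the
output `y` when the input is `x` and the current state is `s`. -/
structure FSC (X Y S : Type) [Fintype Y] [Fintype S] where
  kernel : X → S → S → Y → ℝ
  kernel_nonneg : ∀ x s s' y, 0 ≤ kernel x s s' y
  kernel_sum : ∀ x s, ∑ s', ∑ y, kernel x s s' y = 1

namespace FSC

variable {X Y S : Type} [Fintype Y] [Fintype S] [DecidableEq S]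

/-- `P(y | x, s)`, the one-step output law. -/
def outKernel (W : FSC X Y S) (x : X) (s : S) (y : Y) : ℝ :=
  ∑ s', W.kernel x s s' y

/-- `P(y^n | x^n, s_0)`: the product of the one-step kernels along a state path, summed over all
state paths that start at `s0` (no feedback). -/
def outLaw (W : FSC X Y S) (n : ℕ) (s0 : S) (x : Fin n → X) (y : Fin n → Y) : ℝ :=
  ∑ s : Fin (n + 1) → S,
    if s 0 = s0 then ∏ i : Fin n, W.kernel (x i) (s i.castSucc) (s i.succ) (y i) else 0

theorem outLaw_nonneg (W : FSC X Y S) (n : ℕ) (s0 : S) (x : Fin n → X) (y : Fin n → Y) :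
    0 ≤ W.outLaw n s0 x y := by
  unfold outLaw
  refine Finset.sum_nonneg fun s _ => ?_
  split_ifs
  · exact Finset.prod_nonneg fun i _ => W.kernel_nonneg _ _ _ _
  · exact le_rfl

/-! ### Operational capacity -/

/-- Average error probability, from initial state `s0`, of the block code of length `n` with
`M` equiprobable messages, encoder `enc` and decoder `dec`. -/
def errorProb (W : FSC X Y S) (n : ℕ) (s0 : S) (M : ℕ)
    (enc : Fin M → Fin n → X) (dec : (Fin n → Y) → Fin M) : ℝ :=
  (1 / (M : ℝ)) * ∑ m : Fin M, ∑ y : Fin n → Y,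
    if dec y = m then 0 else W.outLaw n s0 (enc m) y

/-- The rate `R` (bits per channel use) is achievable from initial state `s0`: for every `η > 0`
and all large `n` there is a block code of length `n` with at least `2 ^ (n R)` messages and error
probability at most `η`.  The code may depend on `s0`. -/
def Achievable (W : FSC X Y S) (s0 : S) (R : ℝ) : Prop :=
  ∀ η : ℝ, 0 < η → ∀ᶠ n : ℕ in atTop,
    ∃ (M : ℕ) (enc : Fin M → Fin n → X) (dec : (Fin n → Y) → Fin M),
      (2 : ℝ) ^ ((n : ℝ) * R) ≤ (M : ℝ) ∧ W.errorProb n s0 M enc dec ≤ η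

/-- Capacity (bits per channel use) from initial state `s0`: the supremum of the achievable rates,
as an extended real number. -/
def capacity (W : FSC X Y S) (s0 : S) : EReal :=
  ⨆ R ∈ {R : ℝ | W.Achievable s0 R}, (R : EReal)

/-! ### Information rates -/

variable [Fintype X]

/-- For a causally conditioned input law `c x y = P(x^n ‖ y^{n-1})`, the sum
`∑ P(x^n, y^n) log₂ (P(y^n ‖ x^n) / P(y^n))` with all laws conditioned on `S_0 = s0`.  A term of
zero probability contributes `0`. -/
def infoSum (W : FSC X Y S) (n : ℕ) (s0 : S) (c : (Fin n → X) → (Fin n → Y) → ℝ) : ℝ :=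
  ∑ x, ∑ y, c x y * W.outLaw n s0 x y *
    Real.logb 2 (W.outLaw n s0 x y / ∑ x', c x' y * W.outLaw n s0 x' y)

/-- `I(X^n; Y^n | S_0 = s0)` in bits, when `X^n` has the law `P`. -/
def mutualInfo (W : FSC X Y S) (n : ℕ) (s0 : S) (P : stdSimplex ℝ (Fin n → X)) : ℝ :=
  W.infoSum n s0 (fun x _ => P.1 x)

/-- `(1 / n) max_{P(x^n)} I(X^n; Y^n | S_0 = s0)`. -/
def infoRate (W : FSC X Y S) (n : ℕ) (s0 : S) : ℝ :=
  (1 / (n : ℝ)) * ⨆ P : stdSimplex ℝ (Fin n → X), W.mutualInfo n s0 P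

/-- A feedback input law: `f t x y` is the conditional law of the next input, given the `t` previous
inputs `x` and the `t` previous outputs `y`. -/
abbrev FeedbackLaw (X Y : Type) [Fintype X] : Type :=
  (t : ℕ) → (Fin t → X) → (Fin t → Y) → stdSimplex ℝ X

/-- `P(x^n ‖ y^{n-1}) = ∏ P(x_t | x^{t-1}, y^{t-1})`. -/
def causalLaw (f : FeedbackLaw X Y) (n : ℕ) (x : Fin n → X) (y : Fin n → Y) : ℝ :=
  ∏ t : Fin n, (f t (fun i => x (Fin.castLE t.isLt.le i))
    (fun i => y (Fin.castLE t.isLt.le i))).1 (x t)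

/-- The directed information `I(X^n → Y^n | S_0 = s0) = ∑_t I(X^t; Y_t | Y^{t-1}, S_0 = s0)` in
bits, when the inputs are generated by `f`. -/
def directedInfo (W : FSC X Y S) (n : ℕ) (s0 : S) (f : FeedbackLaw X Y) : ℝ :=
  W.infoSum n s0 (causalLaw f n)

/-- `(1 / n) max I(X^n → Y^n | S_0 = s0)`, the maximum being over all feedback input laws. -/
def feedbackInfoRate (W : FSC X Y S) (n : ℕ) (s0 : S) : ℝ :=
  (1 / (n : ℝ)) * ⨆ f : FeedbackLaw X Y, W.directedInfo n s0 f

/-! The two suprema are over bounded sets. -/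

theorem infoSum_le (W : FSC X Y S) (n : ℕ) (s0 : S) (c : (Fin n → X) → (Fin n → Y) → ℝ)
    (hc : ∀ x y, 0 ≤ c x y) :
    W.infoSum n s0 c ≤ ∑ x, ∑ y, W.outLaw n s0 x y / Real.log 2 := by
  unfold infoSum
  refine Finset.sum_le_sum fun x _ => Finset.sum_le_sum fun y _ => ?_
  have hl : 0 < Real.log 2 := Real.log_pos one_lt_two
  have hw := W.outLaw_nonneg n s0 x y
  set w := W.outLaw n s0 x y with hwdef
  set q := ∑ x', c x' y * W.outLaw n s0 x' y with hq
  have hle : c x y * w ≤ q :=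
    Finset.single_le_sum (f := fun x' => c x' y * W.outLaw n s0 x' y)
      (fun x' _ => mul_nonneg (hc x' y) (W.outLaw_nonneg n s0 x' y)) (Finset.mem_univ x)
  rcases (mul_nonneg (hc x y) hw).eq_or_lt with h0 | h0
  · rw [← h0, zero_mul]
    positivity
  · have hq0 : 0 < q := h0.trans_le hle
    have hwp : 0 < w := by
      rcases hw.eq_or_lt with h | h
      · rw [← h, mul_zero] at h0
        exact absurd h0 (lt_irrefl _)
      · exact h
    have h1 : Real.log (w / q) ≤ w / q :=
      (Real.log_le_sub_one_of_pos (div_pos hwp hq0)).trans (by linarith)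
    rw [Real.logb, ← mul_div_assoc]
    refine div_le_div_of_nonneg_right ?_ hl.le
    calc c x y * w * Real.log (w / q) ≤ c x y * w * (w / q) :=
          mul_le_mul_of_nonneg_left h1 h0.le
      _ = w * (c x y * w / q) := by ring
      _ ≤ w * 1 := mul_le_mul_of_nonneg_left ((div_le_one hq0).2 hle) hw
      _ = w := mul_one w

theorem bddAbove_mutualInfo (W : FSC X Y S) (n : ℕ) (s0 : S) :
    BddAbove (Set.range (W.mutualInfo n s0)) := by
  refine ⟨∑ x, ∑ y, W.outLaw n s0 x y / Real.log 2, ?_⟩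
  rintro _ ⟨P, rfl⟩
  exact W.infoSum_le n s0 _ (fun x _ => P.2.1 x)

theorem bddAbove_directedInfo (W : FSC X Y S) (n : ℕ) (s0 : S) :
    BddAbove (Set.range (W.directedInfo n s0)) := by
  refine ⟨∑ x, ∑ y, W.outLaw n s0 x y / Real.log 2, ?_⟩
  rintro _ ⟨f, rfl⟩
  exact W.infoSum_le n s0 _ (fun x y => Finset.prod_nonneg fun t _ => (f t _ _).2.1 _)

end FSC

/-! ### Graph-based test distributions and the dual bound -/

/-- A graph-based test distribution: a strongly connected directed graph on `Q` in which every node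
has exactly one outgoing edge for each label `y`, leading to `next q y`, together with a probability
distribution `prob q` on the outgoing edges of every node `q`. -/
structure GraphTest (Y Q : Type) [Fintype Y] where
  next : Q → Y → Q
  connected : ∀ q q' : Q, ∃ ys : List Y, ys.foldl next q = q'
  prob : Q → Y → ℝ
  prob_nonneg : ∀ q y, 0 ≤ prob q y
  prob_sum : ∀ q, ∑ y, prob q y = 1

open Classical in
/-- Relative entropy `D(P ‖ R)` in bits of two probability mass functions on a finite set; it is
infinite unless `P ≪ R`. -/
def relEntropy {Y : Type} [Fintype Y] (P R : Y → ℝ) : ENNReal :=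
  if ∀ y, R y = 0 → P y = 0 then ENNReal.ofReal (∑ y, P y * Real.logb 2 (P y / R y)) else ⊤

namespace GraphTest

variable {X Y S Q : Type} [Fintype Y] [Fintype S] [DecidableEq S] [Fintype Q] [DecidableEq Q]

/-- `z_t(q, s) = P(Q_t = q, S_t = s | x^t, s_0, q_0)`, where the node `Q_t` is driven by the channel
outputs.  Here `x 0, x 1, …` are the channel inputs at times `1, 2, …`. -/
def jointLaw (T : GraphTest Y Q) (W : FSC X Y S) (s0 : S) (q0 : Q) (x : ℕ → X) :
    ℕ → Q → S → ℝ
  | 0 => fun q s => if q = q0 ∧ s = s0 then 1 else 0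
  | t + 1 => fun q' s' => ∑ q, ∑ s, ∑ y,
      if T.next q y = q' then T.jointLaw W s0 q0 x t q s * W.kernel (x t) s s' y else 0

/-- The `n`-letter dual bound
`max_{x^n} (1/n) ∑_{t=1}^n ∑_{q,s} z_{t-1}(q,s) D(P_{Y|X,S}(· | x_t, s) ‖ R_{Y|Q}(· | q))`; only
the first `n` terms of the input sequence matter. -/
def dualRate (T : GraphTest Y Q) (W : FSC X Y S) (s0 : S) (q0 : Q) (n : ℕ) : ENNReal :=
  (⨆ x : ℕ → X, ∑ t ∈ Finset.range n, ∑ q, ∑ s,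
    ENNReal.ofReal (T.jointLaw W s0 q0 x t q s) * relEntropy (W.outKernel (x t) s) (T.prob q))
    / (n : ENNReal)

end GraphTest

/-! ### The dicode erasure channel -/

/-- The dicode erasure channel with erasure probability `ε`: the inputs are `0, 1`, the state is the
previous input, and the output is `x_t - x_{t-1} ∈ {-1, 0, 1}` with probability `1 - ε` and the
erasure symbol `none` with probability `ε`. -/
def dicodeErasure (ε : ℝ) (hε : ε ∈ Set.Icc (0 : ℝ) 1) : FSC (Fin 2) (Option SignType) (Fin 2) where
  kernel x s s' y :=
    if s' = x then
      match y with
      | none => ε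
      | some d => if (d : ℤ) = ((x : ℕ) : ℤ) - ((s : ℕ) : ℤ) then 1 - ε else 0
    else 0
  kernel_nonneg x s s' y := by
    have h0 := hε.1
    have h1 := hε.2
    rcases y with _ | d <;> dsimp only <;> split_ifs <;> linarith
  kernel_sum x s := by
    rw [Finset.sum_eq_single x (fun s' _ h => by simp [h]) (by simp), Fintype.sum_option]
    fin_cases x <;> fin_cases s <;> simp [SignType.univ_eq]

/-- The three-node test distribution for the dicode erasure channel.  The nodes `0` and `1` stand
for a previous input known to be `0` and `1`, the node `2` for an unknown previous input. -/
def dicodeTest (ε p : ℝ) (hε : ε ∈ Set.Icc (0 : ℝ) 1) (hp : p ∈ Set.Icc (0 : ℝ) 1) :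
    GraphTest (Option SignType) (Fin 3) where
  next q y :=
    match y with
    | none => 2
    | some SignType.neg => 0
    | some SignType.zero => q
    | some SignType.pos => 1
  connected q q' := by
    fin_cases q'
    · exact ⟨[some SignType.neg], rfl⟩
    · exact ⟨[some SignType.pos], rfl⟩
    · exact ⟨[none], rfl⟩
  prob q y :=
    match y with
    | none => ε
    | some SignType.neg => ![0, (1 - ε) / 2, p * (1 - ε) / 2] q
    | some SignType.zero => ![(1 - ε) / 2, (1 - ε) / 2, (1 - p) * (1 - ε)] q
    | some SignType.pos => ![(1 - ε) / 2, 0, p * (1 - ε) / 2] q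
  prob_nonneg q y := by
    have h0 := hε.1
    have h1 : 0 ≤ 1 - ε := by linarith [hε.2]
    have h2 := hp.1
    have h3 : 0 ≤ 1 - p := by linarith [hp.2]
    rcases y with _ | _ | _ | _ <;> fin_cases q <;> simp <;> positivity
  prob_sum q := by
    rw [Fintype.sum_option]
    fin_cases q <;> simp [SignType.univ_eq]
    all_goals ring

end

/-!
The channel state is the previous input, so the output law of the dicode erasure channel is a plain
product along `s₀, x₁, x₂, …`, and it is compared with the product law `R(yⁿ)` of the edge labels
along the path in the test graph. Everything follows from one identity. Give node `2` (previous
input unknown) the potential `-(1 - ε) log₂ p`, and the other two nodes the potential `0`. Because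
`p ^ ε = 2 (1 - p)`, at every node `q`, for every state `s` consistent with it and *every* input
`x`,
  `D(P(· | x, s) ‖ R(· | q)) + 𝔼[h(next node)] = B(ε) + h(q)`
(`dicodeTest_isPotential`). The costs therefore telescope: whatever the inputs, with or without
feedback, `n` steps cost `n B(ε)` up to a bounded error (`GraphTest.IsPotential`).

* The dual bound is `B(ε)`: the cost of each input sequence is `n B(ε) + O(1)`.
* Mutual and directed information are at most the cost, since replacing the output law by `R` adds
  a relative entropy (`sum_mul_logb_div_le`). The operational capacity is bounded by a Fano
  inequality in which `R` plays the role of the law independent of the message.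
* The feedback capacity is `B(ε)` because some feedback law has output law exactly `R`: uniform
  inputs while the state is known, and a change of the input with probability `p` while it is not.
  The receiver's posterior of the state is then uniform at node `2`
  (`GraphTest.sum_belief_mul_causalLaw`).
* The mutual information rates converge by Fekete's lemma: blocks of lengths `m` and `n` satisfy
  `C(m + n) ≤ C(m) + C(n) + 1`, where the last bit pays for the intermediate state
  (`channelInfo_prod_le`). The limit does not depend on the initial state, which only relabels the
  first output.
-/

/-! ### Gibbs' inequality and mutual information -/

/-- Gibbs' inequality, term by term. -/
theorem sub_le_mul_log_div {a b : ℝ} (ha : 0 ≤ a) (hb : 0 ≤ b) (hab : 0 < a → 0 < b) :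
    a - b ≤ a * Real.log (a / b) := by
  rcases ha.eq_or_lt with rfl | ha'
  · simpa using hb
  have hb' := hab ha'
  have h := Real.one_sub_inv_le_log_of_pos (div_pos ha' hb')
  calc a - b = a * (1 - (a / b)⁻¹) := by field_simp
    _ ≤ _ := mul_le_mul_of_nonneg_left h ha

/-- Replacing the output law by any other law `R` on the outputs can only increase the information
functional: the difference is the relative entropy of the output law with respect to `R`. -/
theorem sum_mul_logb_div_le {A Y : Type} [Fintype A] [Fintype Y] {c K : A → Y → ℝ} {R : Y → ℝ}
    (hc : ∀ x y, 0 ≤ c x y) (hK : ∀ x y, 0 ≤ K x y) (hR : ∀ y, 0 ≤ R y)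
    (hac : ∀ x y, 0 < c x y → 0 < K x y → 0 < R y)
    (hsum : ∑ y, R y ≤ ∑ x, ∑ y, c x y * K x y) :
    ∑ x, ∑ y, c x y * K x y * Real.logb 2 (K x y / ∑ x', c x' y * K x' y)
      ≤ ∑ x, ∑ y, c x y * K x y * Real.logb 2 (K x y / R y) := by
  have hl : 0 < Real.log 2 := Real.log_pos one_lt_two
  set q : Y → ℝ := fun y => ∑ x, c x y * K x y with hq
  have hcK : ∀ x y, 0 ≤ c x y * K x y := fun x y => mul_nonneg (hc x y) (hK x y)
  have hq0 : ∀ y, 0 ≤ q y := fun y => Finset.sum_nonneg fun x _ => hcK x y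
  have hqR : ∀ y, 0 < q y → 0 < R y := by
    intro y hy
    obtain ⟨x, -, hx⟩ := Finset.exists_lt_of_sum_lt (s := Finset.univ) (f := fun _ : A => (0 : ℝ))
      (g := fun x => c x y * K x y) (by simpa using hy)
    refine hac x y ((hc x y).lt_of_ne ?_) ((hK x y).lt_of_ne ?_) <;>
      · intro h; rw [← h] at hx; simp at hx
  have key : ∀ x y, c x y * K x y * Real.logb 2 (K x y / R y)
      = c x y * K x y * Real.logb 2 (K x y / q y) + c x y * K x y * Real.logb 2 (q y / R y) := by
    intro x y
    rcases (hcK x y).eq_or_lt with h | h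
    · simp [← h]
    have hqy : 0 < q y :=
      h.trans_le (Finset.single_le_sum (f := fun x => c x y * K x y) (fun x _ => hcK x y)
        (Finset.mem_univ x))
    have hRy := hqR y hqy
    have hKy : K x y ≠ 0 := by rintro h0; simp [h0] at h
    rw [← mul_add, ← Real.logb_mul (div_ne_zero hKy hqy.ne') (div_ne_zero hqy.ne' hRy.ne'),
      div_mul_div_cancel₀ hqy.ne']
  have hdiv : 0 ≤ ∑ x, ∑ y, c x y * K x y * Real.logb 2 (q y / R y) := by
    rw [Finset.sum_comm]
    have h1 : ∀ y, ∑ x, c x y * K x y * Real.logb 2 (q y / R y)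
        = q y * Real.log (q y / R y) / Real.log 2 := by
      intro y
      rw [← Finset.sum_mul, Real.logb, mul_div_assoc]
    simp_rw [h1]
    rw [← Finset.sum_div]
    refine div_nonneg ?_ hl.le
    have h2 : ∑ y, (q y - R y) ≤ ∑ y, q y * Real.log (q y / R y) :=
      Finset.sum_le_sum fun y _ => sub_le_mul_log_div (hq0 y) (hR y) (hqR y)
    rw [Finset.sum_sub_distrib] at h2
    have h3 : ∑ y, q y = ∑ x, ∑ y, c x y * K x y := Finset.sum_comm
    linarith
  simp_rw [key, Finset.sum_add_distrib]
  exact le_add_of_nonneg_right hdiv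

/-- The chain rule for one step of a relative entropy: `V`, `R` are the probabilities of the first
letter under the two laws, and `K i`, `T i` those of the remaining letters. -/
theorem sum_mul_logb_mul_div_mul {ι : Type} [Fintype ι] {μ K T : ι → ℝ} {V R : ℝ} (hV : 0 ≤ V)
    (hR : 0 < V → 0 < R) (hK : ∀ i, 0 ≤ K i) (hT : 0 < V → ∀ i, 0 < K i → 0 < T i) :
    ∑ i, μ i * (V * K i) * Real.logb 2 (V * K i / (R * T i))
      = V * (Real.logb 2 (V / R) * ∑ i, μ i * K i + ∑ i, μ i * K i * Real.logb 2 (K i / T i)) := by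
  rcases hV.eq_or_lt with h | h
  · simp [← h]
  rw [Finset.mul_sum, ← Finset.sum_add_distrib, Finset.mul_sum]
  refine Finset.sum_congr rfl fun i _ => ?_
  rcases (hK i).eq_or_lt with hi | hi
  · simp [← hi]
  rw [mul_div_mul_comm, Real.logb_mul (div_pos h (hR h)).ne' (div_pos hi (hT h i hi)).ne']
  ring

/-- Mutual information, in bits, of the input law `P` and the channel law `K`. -/
noncomputable def channelInfo {A Y : Type} [Fintype A] [Fintype Y] (P : A → ℝ)
    (K : A → Y → ℝ) : ℝ :=
  ∑ x, ∑ y, P x * K x y * Real.logb 2 (K x y / ∑ x', P x' * K x' y)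

/-- A nonnegative weight on a finite set is its total mass times a probability law. -/
theorem exists_stdSimplex_smul {A : Type} [Fintype A] [Nonempty A] {J : A → ℝ}
    (hJ : ∀ a, 0 ≤ J a) : ∃ P ∈ stdSimplex ℝ A, ∀ a, J a = (∑ b, J b) * P a := by
  classical
  rcases (Finset.sum_nonneg fun a (_ : a ∈ Finset.univ) => hJ a).eq_or_lt with h | h
  · have h0 := (Finset.sum_eq_zero_iff_of_nonneg fun a _ => hJ a).1 h.symm
    refine ⟨Pi.single (Classical.arbitrary A) 1, single_mem_stdSimplex _ _, fun a => ?_⟩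
    rw [← h, h0 a (Finset.mem_univ a), zero_mul]
  · refine ⟨fun a => J a / ∑ b, J b, ⟨fun a => div_nonneg (hJ a) h.le, ?_⟩, fun a => ?_⟩
    · rw [← Finset.sum_div, div_self h.ne']
    · field_simp

/-- Mutual information of two consecutive blocks, where the second block sees the first only through
the state `σ a`: it is at most the sum of the two block capacities, plus the `log₂ |S|` bits that
the second output can reveal about the intermediate state.  The bound comes from the product test
law `R₁ ⊗ |S|⁻¹ ∑ R₂(· | s)`. -/
theorem channelInfo_prod_le {A₁ A₂ Y₁ Y₂ S : Type} [Fintype A₁] [Fintype A₂] [Nonempty A₂]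
    [Fintype Y₁] [Fintype Y₂] [Fintype S] [DecidableEq S] [Nonempty S]
    {K₁ : A₁ → Y₁ → ℝ} {K₂ : S → A₂ → Y₂ → ℝ} (σ : A₁ → S)
    (h₁ : ∀ a y, 0 ≤ K₁ a y) (h₂ : ∀ s a y, 0 ≤ K₂ s a y)
    (s₁ : ∀ a, ∑ y, K₁ a y = 1) (s₂ : ∀ s a, ∑ y, K₂ s a y = 1) {C₁ C₂ : ℝ}
    (hC₁ : ∀ P ∈ stdSimplex ℝ A₁, channelInfo P K₁ ≤ C₁)
    (hC₂ : ∀ s, ∀ P ∈ stdSimplex ℝ A₂, channelInfo P (K₂ s) ≤ C₂)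
    {P : A₁ × A₂ → ℝ} (hP : P ∈ stdSimplex ℝ (A₁ × A₂)) :
    channelInfo P (fun a (y : Y₁ × Y₂) => K₁ a.1 y.1 * K₂ (σ a.1) a.2 y.2)
      ≤ C₁ + (C₂ + Real.logb 2 (Fintype.card S)) := by
  have hN : (0 : ℝ) < Fintype.card S := by exact_mod_cast Fintype.card_pos
  set P₁ : A₁ → ℝ := fun a => ∑ b, P (a, b) with hP₁
  have hP₁m : P₁ ∈ stdSimplex ℝ A₁ :=
    ⟨fun a => Finset.sum_nonneg fun b _ => hP.1 _, by rw [← hP.2, Fintype.sum_prod_type]⟩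
  -- the joint law of the intermediate state and the second input block
  set J : S → A₂ → ℝ := fun s b => ∑ a, if σ a = s then P (a, b) else 0 with hJ
  have hJ0 : ∀ s b, 0 ≤ J s b := fun s b =>
    Finset.sum_nonneg fun a _ => by split_ifs; exacts [hP.1 _, le_rfl]
  choose P₂ hP₂m hP₂ using fun s => exists_stdSimplex_smul (hJ0 s)
  have hJsum : ∑ s, ∑ b, J s b = 1 := by
    rw [← hP.2, Fintype.sum_prod_type, Finset.sum_comm, Finset.sum_comm (γ := A₁)]
    refine Finset.sum_congr rfl fun b _ => ?_
    rw [Finset.sum_comm]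
    simp
  have hPJ : ∀ a b, P (a, b) ≤ J (σ a) b := by
    intro a b
    have := Finset.single_le_sum (f := fun a' => if σ a' = σ a then P (a', b) else 0)
      (fun a' _ => by split_ifs; exacts [hP.1 _, le_rfl]) (Finset.mem_univ a)
    simpa using this
  set R₁ : Y₁ → ℝ := fun y => ∑ a, P₁ a * K₁ a y with hR₁
  set R₂ : S → Y₂ → ℝ := fun s y => ∑ b, P₂ s b * K₂ s b y with hR₂
  set R : Y₂ → ℝ := fun y => (∑ s, R₂ s y) / Fintype.card S with hR
  have hR₁0 : ∀ y, 0 ≤ R₁ y := fun y => Finset.sum_nonneg fun a _ => mul_nonneg (hP₁m.1 a) (h₁ a y)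
  have hR₂0 : ∀ s y, 0 ≤ R₂ s y := fun s y =>
    Finset.sum_nonneg fun b _ => mul_nonneg ((hP₂m s).1 b) (h₂ s b y)
  have hR0 : ∀ y, 0 ≤ R y := fun y =>
    div_nonneg (Finset.sum_nonneg fun s _ => hR₂0 s y) hN.le
  have hsumR₁ : ∑ y, R₁ y = 1 := by
    rw [hR₁, Finset.sum_comm]
    simp_rw [← Finset.mul_sum, s₁, mul_one]
    exact hP₁m.2
  have hsumR₂ : ∀ s, ∑ y, R₂ s y = 1 := by
    intro s
    rw [hR₂, Finset.sum_comm]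
    simp_rw [← Finset.mul_sum, s₂, mul_one]
    exact (hP₂m s).2
  have hsumR : ∑ y, R y = 1 := by
    rw [hR, ← Finset.sum_div, Finset.sum_comm]
    simp [hsumR₂, hN.ne']
  have hR₁pos : ∀ a b y, 0 < P (a, b) → 0 < K₁ a y → 0 < R₁ y := by
    intro a b y hp hk
    have : P (a, b) ≤ P₁ a :=
      Finset.single_le_sum (f := fun b => P (a, b)) (fun b _ => hP.1 _) (Finset.mem_univ b)
    exact (mul_pos (hp.trans_le this) hk).trans_le (Finset.single_le_sum
      (f := fun a => P₁ a * K₁ a y) (fun a _ => mul_nonneg (hP₁m.1 a) (h₁ a y)) (Finset.mem_univ a))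
  have hP₂pos : ∀ s b, 0 < J s b → 0 < P₂ s b := by
    intro s b h
    refine ((hP₂m s).1 b).lt_of_ne fun h0 => ?_
    rw [hP₂ s b, ← h0, mul_zero] at h
    exact lt_irrefl _ h
  have hR₂pos : ∀ s b y, 0 < J s b → 0 < K₂ s b y → 0 < R₂ s y := by
    intro s b y hj hk
    exact (mul_pos (hP₂pos s b hj) hk).trans_le (Finset.single_le_sum
      (f := fun b => P₂ s b * K₂ s b y) (fun b _ => mul_nonneg ((hP₂m s).1 b) (h₂ s b y))
      (Finset.mem_univ b))
  have hRR₂ : ∀ s y, R₂ s y / Fintype.card S ≤ R y := fun s y =>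
    div_le_div_of_nonneg_right (Finset.single_le_sum (f := fun s => R₂ s y)
      (fun s _ => hR₂0 s y) (Finset.mem_univ s)) hN.le
  have hRpos : ∀ s b y, 0 < J s b → 0 < K₂ s b y → 0 < R y := fun s b y hj hk =>
    (div_pos (hR₂pos s b y hj hk) hN).trans_le (hRR₂ s y)
  have step := sum_mul_logb_div_le (c := fun (a : A₁ × A₂) (_ : Y₁ × Y₂) => P a)
    (K := fun a y => K₁ a.1 y.1 * K₂ (σ a.1) a.2 y.2) (R := fun y => R₁ y.1 * R y.2)
    (fun a _ => hP.1 a) (fun a y => mul_nonneg (h₁ _ _) (h₂ _ _ _))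
    (fun y => mul_nonneg (hR₁0 _) (hR0 _))
    (by
      rintro ⟨a, b⟩ ⟨y, z⟩ hp hk
      have hk1 : 0 < K₁ a y := (h₁ a y).lt_of_ne fun h => by simp [← h] at hk
      have hk2 : 0 < K₂ (σ a) b z := (h₂ _ b z).lt_of_ne fun h => by simp [← h] at hk
      exact mul_pos (hR₁pos a b y hp hk1) (hRpos (σ a) b z (hp.trans_le (hPJ a b)) hk2))
    (by
      have e1 : ∑ y : Y₁ × Y₂, R₁ y.1 * R y.2 = 1 := by
        rw [Fintype.sum_prod_type]
        simp_rw [← Finset.mul_sum, hsumR, mul_one]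
        exact hsumR₁
      have e2 : ∀ a : A₁ × A₂,
          ∑ y : Y₁ × Y₂, P a * (K₁ a.1 y.1 * K₂ (σ a.1) a.2 y.2) = P a := by
        intro a
        rw [← Finset.mul_sum, Fintype.sum_prod_type]
        simp_rw [← Finset.mul_sum, s₂, mul_one, s₁, mul_one]
      rw [e1]
      simp_rw [e2]
      exact hP.2.ge)
  refine step.trans ?_
  have split : ∀ (a : A₁) (b : A₂), ∑ y : Y₁ × Y₂, P (a, b) * (K₁ a y.1 * K₂ (σ a) b y.2) *
        Real.logb 2 (K₁ a y.1 * K₂ (σ a) b y.2 / (R₁ y.1 * R y.2))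
      = ∑ y, P (a, b) * K₁ a y * Real.logb 2 (K₁ a y / R₁ y)
        + ∑ z, P (a, b) * K₂ (σ a) b z * Real.logb 2 (K₂ (σ a) b z / R z) := by
    intro a b
    rcases (hP.1 (a, b)).eq_or_lt with hp | hp
    · simp [← hp]
    rw [Fintype.sum_prod_type]
    have e : ∀ y, ∑ z, P (a, b) * (K₁ a y * K₂ (σ a) b z) *
          Real.logb 2 (K₁ a y * K₂ (σ a) b z / (R₁ y * R z))
        = K₁ a y * (Real.logb 2 (K₁ a y / R₁ y) * P (a, b)
          + ∑ z, P (a, b) * K₂ (σ a) b z * Real.logb 2 (K₂ (σ a) b z / R z)) := by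
      intro y
      rw [sum_mul_logb_mul_div_mul (μ := fun _ => P (a, b)) (h₁ a y) (hR₁pos a b y hp)
        (h₂ _ b) (fun _ z => hRpos (σ a) b z (hp.trans_le (hPJ a b))), ← Finset.mul_sum, s₂,
        mul_one]
    simp_rw [e, mul_add, Finset.sum_add_distrib, ← Finset.sum_mul, s₁, one_mul]
    congr 1
    exact Finset.sum_congr rfl fun y _ => by ring
  rw [Fintype.sum_prod_type]
  simp only [split, Finset.sum_add_distrib]
  refine add_le_add ?_ ?_
  · refine le_of_eq_of_le ?_ (hC₁ P₁ hP₁m)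
    refine Finset.sum_congr rfl fun a _ => ?_
    rw [Finset.sum_comm]
    refine Finset.sum_congr rfl fun y _ => ?_
    rw [← Finset.sum_mul, ← Finset.sum_mul]
  · have regroup : ∑ a, ∑ b, ∑ z, P (a, b) * K₂ (σ a) b z * Real.logb 2 (K₂ (σ a) b z / R z)
        = ∑ s, ∑ b, ∑ z, J s b * K₂ s b z * Real.logb 2 (K₂ s b z / R z) := by
      have e : ∀ s, ∑ b, ∑ z, J s b * K₂ s b z * Real.logb 2 (K₂ s b z / R z)
          = ∑ a, if σ a = s then ∑ b, ∑ z, P (a, b) * K₂ s b z * Real.logb 2 (K₂ s b z / R z)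
            else 0 := by
        intro s
        calc ∑ b, ∑ z, J s b * K₂ s b z * Real.logb 2 (K₂ s b z / R z)
            = ∑ b, ∑ a, ∑ z, (if σ a = s then P (a, b) else 0) * K₂ s b z *
                Real.logb 2 (K₂ s b z / R z) := by
              refine Finset.sum_congr rfl fun b _ => ?_
              rw [Finset.sum_comm]
              refine Finset.sum_congr rfl fun z _ => ?_
              rw [← Finset.sum_mul, ← Finset.sum_mul]
          _ = _ := by
              rw [Finset.sum_comm]
              refine Finset.sum_congr rfl fun a _ => ?_
              split_ifs <;> simp
      rw [Finset.sum_congr rfl fun s _ => e s]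
      symm
      rw [Finset.sum_comm]
      refine Finset.sum_congr rfl fun a _ => ?_
      rw [Finset.sum_ite_eq, if_pos (Finset.mem_univ _)]
    rw [regroup]
    have bound : ∀ s, ∑ b, ∑ z, J s b * K₂ s b z * Real.logb 2 (K₂ s b z / R z)
        ≤ (∑ b, J s b) * (C₂ + Real.logb 2 (Fintype.card S)) := by
      intro s
      have hm : 0 ≤ ∑ b, J s b := Finset.sum_nonneg fun b _ => hJ0 s b
      refine le_trans ?_ (mul_le_mul_of_nonneg_left (add_le_add_left (hC₂ s (P₂ s) (hP₂m s)) _) hm)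
      have e : ∀ b, ∑ z, J s b * K₂ s b z * Real.logb 2 (K₂ s b z / R z)
          ≤ (∑ b, J s b) * (∑ z, P₂ s b * K₂ s b z * Real.logb 2 (K₂ s b z / R₂ s z)
            + P₂ s b * Real.logb 2 (Fintype.card S)) := by
        intro b
        have e1 : ∑ z, P₂ s b * K₂ s b z * Real.logb 2 (K₂ s b z / R₂ s z)
            + P₂ s b * Real.logb 2 (Fintype.card S)
            = ∑ z, P₂ s b * K₂ s b z * (Real.logb 2 (K₂ s b z / R₂ s z)
              + Real.logb 2 (Fintype.card S)) := by
          simp_rw [mul_add, Finset.sum_add_distrib, ← Finset.sum_mul, ← Finset.mul_sum, s₂, mul_one]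
        rw [e1, Finset.mul_sum]
        refine Finset.sum_le_sum fun z _ => ?_
        rw [← mul_assoc, ← mul_assoc, ← hP₂ s b]
        rcases (hJ0 s b).eq_or_lt with hj | hj
        · simp [← hj]
        rcases (h₂ s b z).eq_or_lt with hk | hk
        · simp [← hk]
        refine mul_le_mul_of_nonneg_left ?_ (mul_pos hj hk).le
        have hr := hR₂pos s b z hj hk
        rw [← Real.logb_mul (div_pos hk hr).ne' hN.ne']
        refine Real.logb_le_logb_of_le one_lt_two (div_pos hk (hRpos s b z hj hk)) ?_
        calc K₂ s b z / R z ≤ K₂ s b z / (R₂ s z / Fintype.card S) :=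
              div_le_div_of_nonneg_left hk.le (div_pos hr hN) (hRR₂ s z)
          _ = _ := by field_simp
      refine (Finset.sum_le_sum fun b _ => e b).trans (le_of_eq ?_)
      rw [← Finset.mul_sum, Finset.sum_add_distrib, ← Finset.sum_mul, (hP₂m s).2, one_mul]
      rfl
    refine (Finset.sum_le_sum fun s _ => bound s).trans (le_of_eq ?_)
    rw [← Finset.sum_mul, hJsum, one_mul]

/-! ### Channels whose state is the previous input -/

theorem Fin.sum_pi_succ {α : Type} [Fintype α] {n : ℕ} (g : (Fin (n + 1) → α) → ℝ) :
    ∑ x, g x = ∑ a : α, ∑ x : Fin n → α, g (Fin.cons a x) := by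
  rw [← (Fin.consEquiv fun _ : Fin (n + 1) => α).sum_comp, Fintype.sum_prod_type]
  rfl

namespace FSC

variable {X Y S : Type} [Fintype Y] [Fintype S]

/-- The new state of the channel is always the input just sent. -/
def StateIsInput [Fintype X] (W : FSC X Y X) : Prop :=
  ∀ x s s' y, s' ≠ x → W.kernel x s s' y = 0

theorem outKernel_nonneg (W : FSC X Y S) (x : X) (s : S) (y : Y) : 0 ≤ W.outKernel x s y :=
  Finset.sum_nonneg fun _ _ => W.kernel_nonneg _ _ _ _

theorem sum_outKernel (W : FSC X Y S) (x : X) (s : S) : ∑ y, W.outKernel x s y = 1 := by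
  unfold outKernel
  rw [Finset.sum_comm]
  exact W.kernel_sum x s

variable [Fintype X] [DecidableEq X] {W : FSC X Y X}

theorem StateIsInput.kernel_eq (hW : W.StateIsInput) (x s s' : X) (y : Y) :
    W.kernel x s s' y = if s' = x then W.outKernel x s y else 0 := by
  split_ifs with h
  · subst h
    unfold outKernel
    rw [Finset.sum_eq_single s' (fun t _ ht => hW _ _ _ _ ht) (by simp)]
  · exact hW _ _ _ _ h

/-- Only the state path `s₀, x₁, …, xₙ` contributes to the output law. -/
theorem StateIsInput.outLaw_eq_prod (hW : W.StateIsInput) (n : ℕ) (s : X) (x : Fin n → X)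
    (y : Fin n → Y) : W.outLaw n s x y
      = ∏ i : Fin n, W.outKernel (x i) ((Fin.cons s x : Fin (n + 1) → X) i.castSucc) (y i) := by
  unfold outLaw
  rw [Finset.sum_eq_single (Fin.cons s x : Fin (n + 1) → X)]
  · rw [if_pos (Fin.cons_zero _ _)]
    exact Finset.prod_congr rfl fun i _ => by rw [hW.kernel_eq, Fin.cons_succ, if_pos rfl]
  · intro p _ hp
    split_ifs with h0
    · have : ∃ i : Fin n, p i.succ ≠ x i := by
        by_contra! h
        refine hp (funext fun i => ?_)
        refine Fin.cases ?_ (fun j => ?_) i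
        · rw [h0, Fin.cons_zero]
        · rw [h j, Fin.cons_succ]
      obtain ⟨i, hi⟩ := this
      exact Finset.prod_eq_zero (Finset.mem_univ i) (hW _ _ _ _ hi)
    · rfl
  · simp

theorem StateIsInput.outLaw_zero (hW : W.StateIsInput) (s : X) (x : Fin 0 → X) (y : Fin 0 → Y) :
    W.outLaw 0 s x y = 1 := by
  rw [hW.outLaw_eq_prod, Finset.univ_eq_empty, Finset.prod_empty]

theorem StateIsInput.outLaw_cons (hW : W.StateIsInput) (n : ℕ) (s a : X) (b : Y) (x : Fin n → X)
    (y : Fin n → Y) : W.outLaw (n + 1) s (Fin.cons a x) (Fin.cons b y)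
      = W.outKernel a s b * W.outLaw n a x y := by
  rw [hW.outLaw_eq_prod, hW.outLaw_eq_prod, Fin.prod_univ_succ]
  rfl

theorem StateIsInput.sum_outLaw (hW : W.StateIsInput) (n : ℕ) (s : X) (x : Fin n → X) :
    ∑ y, W.outLaw n s x y = 1 := by
  induction n generalizing s with
  | zero => simp [hW.outLaw_zero]
  | succ n ih =>
    rw [← Fin.cons_self_tail x, Fin.sum_pi_succ]
    simp_rw [hW.outLaw_cons, ← Finset.mul_sum, ih, mul_one, W.sum_outKernel]

theorem StateIsInput.outLaw_append (hW : W.StateIsInput) (m n : ℕ) (s : X) (x₁ : Fin m → X)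
    (x₂ : Fin n → X) (y₁ : Fin m → Y) (y₂ : Fin n → Y) :
    W.outLaw (m + n) s (Fin.append x₁ x₂) (Fin.append y₁ y₂)
      = W.outLaw m s x₁ y₁
        * W.outLaw n ((Fin.cons s x₁ : Fin (m + 1) → X) (Fin.last m)) x₂ y₂ := by
  rw [hW.outLaw_eq_prod, hW.outLaw_eq_prod, hW.outLaw_eq_prod, Fin.prod_univ_add]
  congr 1
  · refine Finset.prod_congr rfl fun i _ => ?_
    rw [Fin.append_left, Fin.append_left]
    congr 1
    rcases i with ⟨_ | i, hi⟩
    · rfl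
    · exact Fin.append_left x₁ x₂ ⟨i, by omega⟩
  · refine Finset.prod_congr rfl fun i _ => ?_
    rw [Fin.append_right, Fin.append_right]
    congr 1
    rcases i with ⟨_ | i, hi⟩
    · rcases m with _ | m
      · rfl
      · exact Fin.append_left x₁ x₂ (Fin.last m)
    · exact Fin.append_right x₁ x₂ ⟨i, by omega⟩

/-- The information rates of the blocks are subadditive up to the `log₂ |X|` bits carried by the
intermediate state. -/
theorem StateIsInput.iSup_mutualInfo_add_le [Nonempty X] (hW : W.StateIsInput) {m n : ℕ} {s₀ : X}
    {C₁ C₂ : ℝ} (h₁ : ⨆ P, W.mutualInfo m s₀ P ≤ C₁) (h₂ : ∀ s, ⨆ P, W.mutualInfo n s P ≤ C₂) :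
    ⨆ P, W.mutualInfo (m + n) s₀ P ≤ C₁ + (C₂ + Real.logb 2 (Fintype.card X)) := by
  have hne : Nonempty (stdSimplex ℝ (Fin (m + n) → X)) := inferInstance
  refine ciSup_le fun P => ?_
  set e := Fin.appendEquiv (α := X) m n
  set e' := Fin.appendEquiv (α := Y) m n
  have key := channelInfo_prod_le (K₁ := W.outLaw m s₀) (K₂ := fun s => W.outLaw n s)
    (fun x₁ : Fin m → X => (Fin.cons s₀ x₁ : Fin (m + 1) → X) (Fin.last m))
    (W.outLaw_nonneg m s₀) (fun s => W.outLaw_nonneg n s) (hW.sum_outLaw m s₀)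
    (fun s => hW.sum_outLaw n s)
    (fun Q hQ => (le_ciSup (W.bddAbove_mutualInfo m s₀) ⟨Q, hQ⟩).trans h₁)
    (fun s Q hQ => (le_ciSup (W.bddAbove_mutualInfo n s) ⟨Q, hQ⟩).trans (h₂ s))
    (P := fun a => P.1 (e a)) ⟨fun a => P.2.1 _, by rw [e.sum_comp]; exact P.2.2⟩
  refine le_of_eq_of_le ?_ key
  unfold mutualInfo infoSum channelInfo
  rw [← e.sum_comp]
  refine Finset.sum_congr rfl fun a _ => ?_
  rw [← e'.sum_comp]
  refine Finset.sum_congr rfl fun b _ => ?_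
  rw [← e.sum_comp]
  have h : ∀ a b, W.outLaw (m + n) s₀ (e a) (e' b) = W.outLaw m s₀ a.1 b.1
      * W.outLaw n ((Fin.cons s₀ a.1 : Fin (m + 1) → X) (Fin.last m)) a.2 b.2 :=
    fun a b => hW.outLaw_append m n s₀ a.1 a.2 b.1 b.2
  simp_rw [h]

theorem StateIsInput.mutualInfo_nonneg (hW : W.StateIsInput) (n : ℕ) (s : X)
    (P : stdSimplex ℝ (Fin n → X)) : 0 ≤ W.mutualInfo n s P := by
  have hl : 0 < Real.log 2 := Real.log_pos one_lt_two
  set q : (Fin n → Y) → ℝ := fun y => ∑ x, P.1 x * W.outLaw n s x y with hq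
  have hq0 : ∀ y, 0 ≤ q y := fun y =>
    Finset.sum_nonneg fun x _ => mul_nonneg (P.2.1 x) (W.outLaw_nonneg n s x y)
  have hq1 : ∑ y, q y = 1 := by
    rw [hq, Finset.sum_comm]
    simp_rw [← Finset.mul_sum, hW.sum_outLaw, mul_one]
    exact P.2.2
  unfold mutualInfo infoSum
  refine Finset.sum_nonneg fun x _ => ?_
  rcases (P.2.1 x).eq_or_lt with hx | hx
  · simp [← hx]
  have h : ∑ y, (W.outLaw n s x y - q y) ≤ ∑ y, W.outLaw n s x y *
      Real.log (W.outLaw n s x y / q y) := by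
    refine Finset.sum_le_sum fun y _ => sub_le_mul_log_div (W.outLaw_nonneg n s x y) (hq0 y) ?_
    intro hy
    exact (mul_pos hx hy).trans_le (Finset.single_le_sum (f := fun x => P.1 x * W.outLaw n s x y)
      (fun x _ => mul_nonneg (P.2.1 x) (W.outLaw_nonneg n s x y)) (Finset.mem_univ x))
  rw [Finset.sum_sub_distrib, hW.sum_outLaw, hq1, sub_self] at h
  have e : ∑ y, P.1 x * W.outLaw n s x y * Real.logb 2 (W.outLaw n s x y / q y)
      = P.1 x * (∑ y, W.outLaw n s x y * Real.log (W.outLaw n s x y / q y)) / Real.log 2 := by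
    rw [Finset.mul_sum, Finset.sum_div]
    refine Finset.sum_congr rfl fun y _ => ?_
    rw [Real.logb]
    ring
  exact e ▸ div_nonneg (mul_nonneg hx.le h) hl.le

/-- If the maximal information does not depend on the initial state, the information rates converge,
by Fekete's lemma. -/
theorem StateIsInput.exists_tendsto_infoRate [Nonempty X] (hW : W.StateIsInput)
    (hs : ∀ n s s', ⨆ P, W.mutualInfo n s P = ⨆ P, W.mutualInfo n s' P) :
    ∃ C : ℝ, ∀ s, Tendsto (fun n => W.infoRate n s) atTop (𝓝 C) := by
  obtain ⟨s₀⟩ := ‹Nonempty X›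
  have : Nonempty X := ⟨s₀⟩
  set K := Real.logb 2 (Fintype.card X) with hK
  have hK0 : 0 ≤ K := Real.logb_nonneg one_lt_two (by exact_mod_cast Fintype.card_pos)
  set C : ℕ → ℝ := fun n => ⨆ P, W.mutualInfo n s₀ P with hC
  have hC0 : ∀ n, 0 ≤ C n := fun n => Real.iSup_nonneg fun P => hW.mutualInfo_nonneg n s₀ P
  have hsub : Subadditive fun n => C n + K := by
    intro m n
    have := hW.iSup_mutualInfo_add_le (m := m) (n := n) (s₀ := s₀) (C₁ := C m) (C₂ := C n) le_rfl
      (fun s => (hs n s s₀).le)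
    change C (m + n) + K ≤ _
    change C (m + n) ≤ _ at this
    linarith
  have hlim := hsub.tendsto_lim ⟨0, by
    rintro _ ⟨n, rfl⟩
    exact div_nonneg (add_nonneg (hC0 n) hK0) n.cast_nonneg⟩
  refine ⟨hsub.lim, fun s => ?_⟩
  have h0 : Tendsto (fun n : ℕ => K / (n : ℝ)) atTop (𝓝 0) :=
    tendsto_const_div_atTop_nhds_zero_nat K
  have := hlim.sub h0
  rw [sub_zero] at this
  refine this.congr fun n => ?_
  rw [infoRate, hs n s s₀]
  change (C n + K) / n - K / n = 1 / n * C n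
  ring

end FSC

/-! ### The output law of a graph-based test distribution -/

namespace GraphTest

variable {Y Q : Type} [Fintype Y]

/-- `R(yⁿ | q₀)`: the product of the edge probabilities along the path labelled `y` from `q`. -/
def pathLaw (T : GraphTest Y Q) : (n : ℕ) → Q → (Fin n → Y) → ℝ
  | 0, _, _ => 1
  | n + 1, q, y => T.prob q (y 0) * T.pathLaw n (T.next q (y 0)) (Fin.tail y)

theorem pathLaw_cons (T : GraphTest Y Q) (n : ℕ) (q : Q) (b : Y) (y : Fin n → Y) :
    T.pathLaw (n + 1) q (Fin.cons b y) = T.prob q b * T.pathLaw n (T.next q b) y := rfl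

theorem pathLaw_nonneg (T : GraphTest Y Q) (n : ℕ) (q : Q) (y : Fin n → Y) :
    0 ≤ T.pathLaw n q y := by
  induction n generalizing q with
  | zero => exact zero_le_one
  | succ n ih => exact mul_nonneg (T.prob_nonneg _ _) (ih _ _)

theorem sum_pathLaw (T : GraphTest Y Q) (n : ℕ) (q : Q) : ∑ y, T.pathLaw n q y = 1 := by
  induction n generalizing q with
  | zero => simp [pathLaw]
  | succ n ih =>
    rw [Fin.sum_pi_succ]
    simp_rw [pathLaw_cons, ← Finset.mul_sum, ih, mul_one, T.prob_sum]

end GraphTest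

/-! ### Causal input laws -/

namespace FSC

variable {X Y : Type} [Fintype X]

/-- The feedback input law that remains after the first input `a` and the first output `b`. -/
def FeedbackLaw.after (f : FeedbackLaw X Y) (a : X) (b : Y) : FeedbackLaw X Y :=
  fun t x y => f (t + 1) (Fin.cons a x) (Fin.cons b y)

/-- The law of the first input. -/
def FeedbackLaw.first (f : FeedbackLaw X Y) : stdSimplex ℝ X :=
  f 0 Fin.elim0 Fin.elim0

theorem causalLaw_nonneg (f : FeedbackLaw X Y) (n : ℕ) (x : Fin n → X) (y : Fin n → Y) :
    0 ≤ causalLaw f n x y :=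
  Finset.prod_nonneg fun t _ => (f t _ _).2.1 _

theorem causalLaw_cons (f : FeedbackLaw X Y) (n : ℕ) (a : X) (b : Y) (x : Fin n → X)
    (y : Fin n → Y) : causalLaw f (n + 1) (Fin.cons a x) (Fin.cons b y)
      = f.first.1 a * causalLaw (f.after a b) n x y := by
  unfold causalLaw
  rw [Fin.prod_univ_succ]
  have hc : ∀ (α : Type) (t : Fin n) (u : α) (v : Fin n → α),
      (fun i : Fin (t.1 + 1) =>
        (Fin.cons u v : Fin (n + 1) → α) (Fin.castLE t.succ.isLt.le i))
      = Fin.cons u fun i => v (Fin.castLE t.isLt.le i) := by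
    intro α t u v
    funext i
    refine Fin.cases rfl (fun j => rfl) i
  congr 1
  · exact congrArg (fun v : stdSimplex ℝ X => v.1 a)
      (congrArg₂ (f 0) (Subsingleton.elim _ _) (Subsingleton.elim _ _))
  · refine Finset.prod_congr rfl fun t _ => ?_
    unfold FeedbackLaw.after
    rw [← hc, ← hc]
    rfl

theorem StateIsInput.sum_causalLaw_mul_outLaw [Fintype Y] [DecidableEq X] {W : FSC X Y X}
    (hW : W.StateIsInput) (f : FeedbackLaw X Y) (n : ℕ) (s : X) :
    ∑ x, ∑ y, causalLaw f n x y * W.outLaw n s x y = 1 := by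
  induction n generalizing f s with
  | zero => simp [hW.outLaw_zero, causalLaw]
  | succ n ih =>
    have e : ∀ a b, ∑ x, ∑ y, causalLaw f (n + 1) (Fin.cons a x) (Fin.cons b y)
        * W.outLaw (n + 1) s (Fin.cons a x) (Fin.cons b y)
        = f.first.1 a * W.outKernel a s b := by
      intro a b
      rw [← mul_one (f.first.1 a * _), ← ih (f.after a b) a]
      simp_rw [Finset.mul_sum, causalLaw_cons, hW.outLaw_cons]
      exact Finset.sum_congr rfl fun x _ => Finset.sum_congr rfl fun y _ => by ring
    rw [Fin.sum_pi_succ]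
    simp_rw [Fin.sum_pi_succ (α := Y)]
    calc _ = ∑ a, ∑ b, ∑ x, ∑ y, causalLaw f (n + 1) (Fin.cons a x) (Fin.cons b y)
        * W.outLaw (n + 1) s (Fin.cons a x) (Fin.cons b y) :=
          Finset.sum_congr rfl fun a _ => Finset.sum_comm
      _ = 1 := by
        simp_rw [e, ← Finset.mul_sum, W.sum_outKernel, mul_one]
        exact f.first.2.2

end FSC

/-! ### Potentials for a test distribution -/

namespace GraphTest

variable {X Y Q : Type} [Fintype Y] [Fintype X]

/-- A potential `h` on the nodes, with values in `[0, A]`, that equalizes the dual bound of the test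
distribution `T` at the value `B`: whatever the input, the expected one-step cost plus the gain of
potential is exactly `B`. This is asked only at the pairs of a node and a state in the relation
`Ok`, which the channel never leaves. -/
structure IsPotential (T : GraphTest Y Q) (W : FSC X Y X) (Ok : Q → X → Prop) (h : Q → ℝ)
    (A B : ℝ) : Prop where
  nonneg : ∀ q, 0 ≤ h q
  le : ∀ q, h q ≤ A
  prob_pos : ∀ {q s a b}, Ok q s → 0 < W.outKernel a s b → 0 < T.prob q b
  ok_next : ∀ {q s a b}, Ok q s → 0 < W.outKernel a s b → Ok (T.next q b) a
  sum_eq : ∀ {q s} (a), Ok q s → ∑ b, W.outKernel a s b *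
    (Real.logb 2 (W.outKernel a s b / T.prob q b) + h (T.next q b)) = B + h q

variable {T : GraphTest Y Q} {W : FSC X Y X} {Ok : Q → X → Prop} {h : Q → ℝ} {A B : ℝ}

theorem IsPotential.sum_eq_add (H : T.IsPotential W Ok h A B) {q : Q} {s a : X} (hqs : Ok q s)
    (c : ℝ) :
    ∑ b, W.outKernel a s b * (Real.logb 2 (W.outKernel a s b / T.prob q b) + (c + h (T.next q b)))
      = B + c + h q := by
  have h1 := H.sum_eq a hqs
  have h2 : ∀ b, W.outKernel a s b *
      (Real.logb 2 (W.outKernel a s b / T.prob q b) + (c + h (T.next q b)))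
      = W.outKernel a s b * (Real.logb 2 (W.outKernel a s b / T.prob q b) + h (T.next q b))
        + W.outKernel a s b * c := fun b => by ring
  simp_rw [h2, Finset.sum_add_distrib, h1, ← Finset.sum_mul, W.sum_outKernel]
  ring

variable [DecidableEq X]

namespace IsPotential

theorem pathLaw_pos (H : T.IsPotential W Ok h A B) (hW : W.StateIsInput) {n : ℕ} {q : Q} {s : X}
    (hqs : Ok q s) {x : Fin n → X} {y : Fin n → Y} (hpos : 0 < W.outLaw n s x y) :
    0 < T.pathLaw n q y := by
  induction n generalizing q s with
  | zero => exact one_pos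
  | succ n ih =>
    rw [← Fin.cons_self_tail x, ← Fin.cons_self_tail y, hW.outLaw_cons] at hpos
    have h1 : 0 < W.outKernel (x 0) s (y 0) :=
      (W.outKernel_nonneg _ _ _).lt_of_ne fun h => by simp [← h] at hpos
    exact mul_pos (H.prob_pos hqs h1)
      (ih (H.ok_next hqs h1) (pos_of_mul_pos_right hpos h1.le))

/-- The relative entropy of the output law for the inputs `x` with respect to the test law. -/
theorem sum_outLaw_mul_logb_le (H : T.IsPotential W Ok h A B) (hW : W.StateIsInput) {n : ℕ} {q : Q}
    {s : X} (hqs : Ok q s) (x : Fin n → X) :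
    ∑ y, W.outLaw n s x y * Real.logb 2 (W.outLaw n s x y / T.pathLaw n q y) ≤ n * B + h q := by
  induction n generalizing q s with
  | zero => simpa [hW.outLaw_zero, pathLaw] using H.nonneg q
  | succ n ih =>
    rw [← Fin.cons_self_tail x, Fin.sum_pi_succ]
    set a := x 0
    have e : ∀ b, ∑ y, W.outLaw (n + 1) s (Fin.cons a (Fin.tail x)) (Fin.cons b y) * Real.logb 2
          (W.outLaw (n + 1) s (Fin.cons a (Fin.tail x)) (Fin.cons b y)
            / T.pathLaw (n + 1) q (Fin.cons b y))
        ≤ W.outKernel a s b * (Real.logb 2 (W.outKernel a s b / T.prob q b)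
          + (n * B + h (T.next q b))) := by
      intro b
      have := sum_mul_logb_mul_div_mul (μ := fun _ : Fin n → Y => 1)
        (K := W.outLaw n a (Fin.tail x)) (T := T.pathLaw n (T.next q b)) (W.outKernel_nonneg a s b)
        (H.prob_pos hqs) (W.outLaw_nonneg n a _)
        (fun hV y hy => H.pathLaw_pos hW (H.ok_next hqs hV) hy)
      simp_rw [one_mul, hW.sum_outLaw, mul_one] at this
      simp_rw [hW.outLaw_cons, pathLaw_cons]
      rw [this]
      rcases (W.outKernel_nonneg a s b).eq_or_lt with hV | hV
      · simp [← hV]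
      · exact mul_le_mul_of_nonneg_left (add_le_add_right (ih (H.ok_next hqs hV) _) _) hV.le
    refine (Finset.sum_le_sum fun b _ => e b).trans (le_of_eq ?_)
    rw [H.sum_eq_add hqs]
    push_cast
    ring

/-- With feedback, the expected cost is still pinned down up to the final potential. -/
theorem sum_causalLaw_mul_logb_mem (H : T.IsPotential W Ok h A B) (hW : W.StateIsInput) {n : ℕ}
    {q : Q} {s : X} (hqs : Ok q s) (f : FSC.FeedbackLaw X Y) :
    ∑ x, ∑ y, FSC.causalLaw f n x y * W.outLaw n s x y
        * Real.logb 2 (W.outLaw n s x y / T.pathLaw n q y)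
      ∈ Set.Icc (n * B + h q - A) (n * B + h q) := by
  induction n generalizing q s f with
  | zero => simpa [hW.outLaw_zero, pathLaw] using ⟨H.le q, H.nonneg q⟩
  | succ n ih =>
    set F : X → Y → ℝ := fun a b => ∑ x, ∑ y, FSC.causalLaw (f.after a b) n x y
      * W.outLaw n a x y * Real.logb 2 (W.outLaw n a x y / T.pathLaw n (T.next q b) y) with hF
    have e : ∀ a b, ∑ x, ∑ y, FSC.causalLaw f (n + 1) (Fin.cons a x) (Fin.cons b y)
          * W.outLaw (n + 1) s (Fin.cons a x) (Fin.cons b y)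
          * Real.logb 2 (W.outLaw (n + 1) s (Fin.cons a x) (Fin.cons b y)
            / T.pathLaw (n + 1) q (Fin.cons b y))
        = f.first.1 a * (W.outKernel a s b *
          (Real.logb 2 (W.outKernel a s b / T.prob q b) + F a b)) := by
      intro a b
      have := sum_mul_logb_mul_div_mul
        (μ := fun z : (Fin n → X) × (Fin n → Y) => FSC.causalLaw (f.after a b) n z.1 z.2)
        (K := fun z => W.outLaw n a z.1 z.2) (T := fun z => T.pathLaw n (T.next q b) z.2)
        (W.outKernel_nonneg a s b) (H.prob_pos hqs) (fun z => W.outLaw_nonneg n a _ _)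
        (fun hV z hz => H.pathLaw_pos hW (H.ok_next hqs hV) hz)
      simp_rw [Fintype.sum_prod_type, hW.sum_causalLaw_mul_outLaw, mul_one] at this
      rw [hF, ← this, Finset.mul_sum]
      refine Finset.sum_congr rfl fun x _ => ?_
      rw [Finset.mul_sum]
      refine Finset.sum_congr rfl fun y _ => ?_
      rw [FSC.causalLaw_cons, hW.outLaw_cons, pathLaw_cons]
      ring
    have total : ∑ x, ∑ y, FSC.causalLaw f (n + 1) x y * W.outLaw (n + 1) s x y
          * Real.logb 2 (W.outLaw (n + 1) s x y / T.pathLaw (n + 1) q y)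
        = ∑ a, f.first.1 a * ∑ b, (W.outKernel a s b *
          (Real.logb 2 (W.outKernel a s b / T.prob q b) + F a b)) := by
      rw [Fin.sum_pi_succ]
      simp_rw [Fin.sum_pi_succ (α := Y)]
      refine Finset.sum_congr rfl fun a _ => ?_
      rw [Finset.sum_comm, Finset.mul_sum]
      exact Finset.sum_congr rfl fun b _ => e a b
    have hmem : ∀ a b, 0 < W.outKernel a s b → F a b ∈ Set.Icc (n * B + h (T.next q b) - A)
        (n * B + h (T.next q b)) := fun a b hV => ih (H.ok_next hqs hV) (f.after a b)
    have hmass : ∀ c : ℝ, ∑ a, f.first.1 a * c = c := fun c => by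
      rw [← Finset.sum_mul, f.first.2.2, one_mul]
    rw [total]
    constructor
    · rw [← hmass (_ - A)]
      refine Finset.sum_le_sum fun a _ => mul_le_mul_of_nonneg_left ?_ (f.first.2.1 a)
      have := H.sum_eq_add (a := a) hqs (n * B - A)
      refine le_of_eq_of_le (b := B + (n * B - A) + h q) (by push_cast; ring) (this ▸ ?_)
      refine Finset.sum_le_sum fun b _ => ?_
      rcases (W.outKernel_nonneg a s b).eq_or_lt with hV | hV
      · simp [← hV]
      · refine mul_le_mul_of_nonneg_left ?_ hV.le
        linarith [(hmem a b hV).1]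
    · rw [← hmass (_ + h q)]
      refine Finset.sum_le_sum fun a _ => mul_le_mul_of_nonneg_left ?_ (f.first.2.1 a)
      have := H.sum_eq_add (a := a) hqs (n * B)
      refine le_of_le_of_eq (b := B + n * B + h q) (this ▸ ?_) (by push_cast; ring)
      refine Finset.sum_le_sum fun b _ => ?_
      rcases (W.outKernel_nonneg a s b).eq_or_lt with hV | hV
      · simp [← hV]
      · refine mul_le_mul_of_nonneg_left ?_ hV.le
        linarith [(hmem a b hV).2]

theorem mutualInfo_le (H : T.IsPotential W Ok h A B) (hW : W.StateIsInput) {n : ℕ}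
    {q : Q} {s : X} (hqs : Ok q s) (P : stdSimplex ℝ (Fin n → X)) :
    W.mutualInfo n s P ≤ n * B + h q := by
  refine (sum_mul_logb_div_le (R := T.pathLaw n q) (fun x _ => P.2.1 x) (W.outLaw_nonneg n s)
    (T.pathLaw_nonneg n q) (fun x y _ hy => H.pathLaw_pos hW hqs hy) ?_).trans ?_
  · simp_rw [← Finset.mul_sum, hW.sum_outLaw, mul_one, T.sum_pathLaw]
    exact P.2.2.ge
  · rw [← one_mul (n * B + h q), ← P.2.2, Finset.sum_mul]
    refine Finset.sum_le_sum fun x _ => ?_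
    simp_rw [mul_assoc, ← Finset.mul_sum]
    exact mul_le_mul_of_nonneg_left (H.sum_outLaw_mul_logb_le hW hqs x) (P.2.1 x)

theorem directedInfo_le (H : T.IsPotential W Ok h A B) (hW : W.StateIsInput) {n : ℕ}
    {q : Q} {s : X} (hqs : Ok q s) (f : FSC.FeedbackLaw X Y) :
    W.directedInfo n s f ≤ n * B + h q := by
  refine (sum_mul_logb_div_le (R := T.pathLaw n q) (FSC.causalLaw_nonneg f n) (W.outLaw_nonneg n s)
    (T.pathLaw_nonneg n q) (fun x y _ hy => H.pathLaw_pos hW hqs hy) ?_).trans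
    (H.sum_causalLaw_mul_logb_mem hW hqs f).2
  rw [hW.sum_causalLaw_mul_outLaw, T.sum_pathLaw]

/-- A feedback law whose output law is the test law attains the dual bound. -/
theorem le_directedInfo (H : T.IsPotential W Ok h A B) (hW : W.StateIsInput) {n : ℕ}
    {q : Q} {s : X} (hqs : Ok q s) (f : FSC.FeedbackLaw X Y)
    (hf : ∀ y, ∑ x, FSC.causalLaw f n x y * W.outLaw n s x y = T.pathLaw n q y) :
    n * B + h q - A ≤ W.directedInfo n s f := by
  unfold FSC.directedInfo FSC.infoSum
  simp_rw [hf]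
  exact (H.sum_causalLaw_mul_logb_mem hW hqs f).1

/-- A Fano inequality. For each message `m`, Gibbs' inequality compares the output law with the test
law reweighted by the number of messages on the decoding region of `m`. -/
theorem one_sub_errorProb_mul_logb_le (H : T.IsPotential W Ok h A B) (hW : W.StateIsInput) {n : ℕ}
    {q : Q} {s : X} (hqs : Ok q s) {M : ℕ} (hM : 0 < M) (enc : Fin M → Fin n → X)
    (dec : (Fin n → Y) → Fin M) :
    (1 - W.errorProb n s M enc dec) * Real.logb 2 M ≤ n * B + h q + 1 / Real.log 2 := by
  have hl : 0 < Real.log 2 := Real.log_pos one_lt_two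
  have hM' : (0 : ℝ) < M := by exact_mod_cast hM
  set R := T.pathLaw n q with hR
  set E : Fin M → ℝ := fun m => ∑ y, if dec y = m then 0 else W.outLaw n s (enc m) y with hE
  set U : Fin M → ℝ := fun m => ∑ y, if dec y = m then R y else 0 with hU
  have hUsum : ∑ m, U m = 1 := by
    rw [hU, Finset.sum_comm, ← T.sum_pathLaw n q]
    exact Finset.sum_congr rfl fun y _ => by simp [hR]
  have key : ∀ m, (1 - E m) * Real.log M - M * U m ≤ (n * B + h q) * Real.log 2 := by
    intro m
    set w := W.outLaw n s (enc m) with hw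
    have hw0 : ∀ y, 0 ≤ w y := W.outLaw_nonneg n s (enc m)
    have hR0 : ∀ y, 0 ≤ R y := T.pathLaw_nonneg n q
    have hterm : ∀ y, w y - (R y + M * if dec y = m then R y else 0)
          + (w y - if dec y = m then 0 else w y) * Real.log M
        ≤ w y * Real.logb 2 (w y / R y) * Real.log 2 := by
      intro y
      have hlog : w y * Real.logb 2 (w y / R y) * Real.log 2 = w y * Real.log (w y / R y) := by
        rw [Real.logb]; field_simp
      rw [hlog]
      have hac : 0 < w y → 0 < R y := H.pathLaw_pos hW hqs
      split_ifs with hd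
      · have h1 := sub_le_mul_log_div (hw0 y) (mul_nonneg hM'.le (hR0 y))
          fun h => mul_pos hM' (hac h)
        have h2 : w y * Real.log (w y / R y)
            = w y * Real.log (w y / (M * R y)) + w y * Real.log M := by
          rcases (hw0 y).eq_or_lt with h | h
          · simp [← h]
          rw [← mul_add, ← Real.log_mul (div_pos h (mul_pos hM' (hac h))).ne' hM'.ne']
          congr 2
          field_simp
        rw [h2]
        linarith [hR0 y]
      · have h1 := sub_le_mul_log_div (hw0 y) (hR0 y) hac
        linarith
    have hsum := Finset.sum_le_sum fun y (_ : y ∈ Finset.univ) => hterm y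
    simp_rw [← Finset.sum_mul, Finset.sum_add_distrib, Finset.sum_sub_distrib,
      Finset.sum_add_distrib, ← Finset.sum_mul, ← Finset.mul_sum, Finset.sum_sub_distrib] at hsum
    rw [hw, hW.sum_outLaw, hR, T.sum_pathLaw] at hsum
    have := mul_le_mul_of_nonneg_right (H.sum_outLaw_mul_logb_le hW hqs (enc m)) hl.le
    have hsum' := hsum.trans this
    change 1 - (1 + M * U m) + (1 - E m) * Real.log M ≤ _ at hsum'
    linarith
  have hsum := Finset.sum_le_sum fun m (_ : m ∈ Finset.univ) => key m
  rw [Finset.sum_sub_distrib, ← Finset.sum_mul, ← Finset.mul_sum, hUsum, Finset.sum_sub_distrib]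
    at hsum
  simp only [Finset.sum_const, Finset.card_univ, Fintype.card_fin, nsmul_eq_mul, mul_one] at hsum
  have herr : W.errorProb n s M enc dec = (∑ m, E m) / M := by
    rw [FSC.errorProb, hE]
    ring
  rw [herr, Real.logb]
  have e1 : (1 - (∑ m, E m) / M) * (Real.log M / Real.log 2)
      = ((M - ∑ m, E m) * Real.log M) / (M * Real.log 2) := by field_simp
  have e2 : (n * B + h q + 1 / Real.log 2) = (M * ((n * B + h q) * Real.log 2) + M)
      / (M * Real.log 2) := by field_simp
  rw [e1, e2]
  exact div_le_div_of_nonneg_right (by linarith) (mul_pos hM' hl).le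

theorem capacity_le (H : T.IsPotential W Ok h A B) (hW : W.StateIsInput) (hB : 0 ≤ B)
    {q : Q} {s : X} (hqs : Ok q s) : W.capacity s ≤ (B : EReal) := by
  refine iSup₂_le fun R hR => EReal.coe_le_coe_iff.2 ?_
  by_contra! hlt
  have hR0 : 0 < R := hB.trans_lt hlt
  set K := h q + 1 / Real.log 2 with hK
  have main : ∀ η : ℝ, 0 < η → η < 1 → (1 - η) * R ≤ B := by
    intro η hη hη1
    have hlim : Tendsto (fun n : ℕ => B + K / (n : ℝ)) atTop (𝓝 B) := by
      simpa using tendsto_const_nhds.add (tendsto_const_div_atTop_nhds_zero_nat K)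
    refine ge_of_tendsto hlim ?_
    filter_upwards [hR η hη, eventually_gt_atTop 0] with n hn hn0
    obtain ⟨M, enc, dec, hM, herr⟩ := hn
    have hn' : (0 : ℝ) < n := by exact_mod_cast hn0
    have hpow : (0 : ℝ) < 2 ^ ((n : ℝ) * R) := Real.rpow_pos_of_pos two_pos _
    have hM0 : (0 : ℝ) < M := hpow.trans_le hM
    have hlog : n * R ≤ Real.logb 2 M := by
      rw [Real.le_logb_iff_rpow_le one_lt_two hM0]
      exact hM
    have fano := H.one_sub_errorProb_mul_logb_le hW hqs (by exact_mod_cast hM0) enc dec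
    have h1 : (1 - η) * (n * R) ≤ n * B + K := by
      calc (1 - η) * (n * R) ≤ (1 - η) * Real.logb 2 M :=
            mul_le_mul_of_nonneg_left hlog (by linarith)
        _ ≤ (1 - W.errorProb n s M enc dec) * Real.logb 2 M :=
            mul_le_mul_of_nonneg_right (by linarith) ((mul_pos hn' hR0).le.trans hlog)
        _ ≤ _ := by linarith
    rw [← mul_le_mul_iff_right₀ hn', mul_add, mul_div_cancel₀ _ hn'.ne']
    linarith
  -- the error probability `η` with `(1 - η) R = (B + R) / 2`
  have := main ((R - B) / (2 * R)) (div_pos (by linarith) (by linarith))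
    ((div_lt_one (by linarith)).2 (by linarith))
  have e : (1 - (R - B) / (2 * R)) * R = (R + B) / 2 := by field_simp; ring
  linarith

end IsPotential

end GraphTest

theorem tendsto_natCast_mul_add_div (B c : ℝ) :
    Tendsto (fun n : ℕ => (n * B + c) / (n : ℝ)) atTop (𝓝 B) := by
  have h : Tendsto (fun n : ℕ => B + c / (n : ℝ)) atTop (𝓝 B) := by
    simpa using tendsto_const_nhds.add (tendsto_const_div_atTop_nhds_zero_nat c)
  refine h.congr' ?_
  filter_upwards [eventually_gt_atTop 0] with n hn
  have : (n : ℝ) ≠ 0 := by exact_mod_cast hn.ne'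
  field_simp

namespace GraphTest

/-! ### The value of the dual bound -/

section Dual

variable {X Y S Q : Type} [Fintype Y] [Fintype S] [DecidableEq S] [Fintype Q] [DecidableEq Q]

theorem jointLaw_nonneg (T : GraphTest Y Q) (W : FSC X Y S) (s₀ : S) (q₀ : Q) (x : ℕ → X) (t : ℕ)
    (q : Q) (s : S) : 0 ≤ T.jointLaw W s₀ q₀ x t q s := by
  induction t generalizing q s with
  | zero => unfold jointLaw; split_ifs <;> simp
  | succ t ih =>
    unfold jointLaw
    refine Finset.sum_nonneg fun q' _ => Finset.sum_nonneg fun s' _ =>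
      Finset.sum_nonneg fun y _ => ?_
    split_ifs
    · exact mul_nonneg (ih _ _) (W.kernel_nonneg _ _ _ _)
    · exact le_rfl

/-- The forward equation for the expectation of a function of the node. -/
theorem sum_jointLaw_succ (T : GraphTest Y Q) (W : FSC X Y S) (s₀ : S) (q₀ : Q) (x : ℕ → X)
    (t : ℕ) (g : Q → ℝ) :
    ∑ q, ∑ s, T.jointLaw W s₀ q₀ x (t + 1) q s * g q
      = ∑ q, ∑ s, T.jointLaw W s₀ q₀ x t q s
        * ∑ y, W.outKernel (x t) s y * g (T.next q y) := by
  set J := T.jointLaw W s₀ q₀ x t with hJ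
  have hrot : ∀ {ι : Type} [Fintype ι] (F : Q → S → ι → ℝ),
      ∑ q, ∑ s, ∑ i, F q s i = ∑ i, ∑ q, ∑ s, F q s i := by
    intro ι _ F
    rw [Finset.sum_comm (s := (Finset.univ : Finset ι))]
    exact Finset.sum_congr rfl fun q _ => Finset.sum_comm
  calc ∑ q', ∑ s', T.jointLaw W s₀ q₀ x (t + 1) q' s' * g q'
      = ∑ q', ∑ s', ∑ q, ∑ s, ∑ y,
          if T.next q y = q' then J q s * W.kernel (x t) s s' y * g q' else 0 := by
        simp_rw [jointLaw, Finset.sum_mul, ite_mul, zero_mul]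
        rfl
    _ = ∑ q, ∑ s, ∑ y, ∑ s', ∑ q',
          if T.next q y = q' then J q s * W.kernel (x t) s s' y * g q' else 0 := by
        rw [hrot]
        refine Finset.sum_congr rfl fun q _ => ?_
        rw [hrot]
        refine Finset.sum_congr rfl fun s _ => ?_
        rw [hrot]
        exact Finset.sum_congr rfl fun y _ => Finset.sum_comm
    _ = _ := by
        refine Finset.sum_congr rfl fun q _ => Finset.sum_congr rfl fun s _ => ?_
        rw [Finset.mul_sum]
        refine Finset.sum_congr rfl fun y _ => ?_
        rw [FSC.outKernel, Finset.sum_mul, Finset.mul_sum]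
        refine Finset.sum_congr rfl fun s' _ => ?_
        rw [Finset.sum_ite_eq, if_pos (Finset.mem_univ _)]
        ring

theorem sum_jointLaw (T : GraphTest Y Q) (W : FSC X Y S) (s₀ : S) (q₀ : Q) (x : ℕ → X) (t : ℕ) :
    ∑ q, ∑ s, T.jointLaw W s₀ q₀ x t q s = 1 := by
  induction t with
  | zero =>
    simp_rw [jointLaw, ite_and]
    simp
  | succ t ih =>
    have := T.sum_jointLaw_succ W s₀ q₀ x t fun _ => 1
    simp only [mul_one, W.sum_outKernel] at this
    rw [this, ih]

end Dual

namespace IsPotential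

variable {X Y Q : Type} [Fintype Y] [Fintype X] {T : GraphTest Y Q} {W : FSC X Y X}
  {Ok : Q → X → Prop} {h : Q → ℝ} {A B : ℝ}

theorem relEntropy_eq (H : T.IsPotential W Ok h A B) {q : Q} {s : X} (hqs : Ok q s) (a : X) :
    relEntropy (W.outKernel a s) (T.prob q) = ENNReal.ofReal
      (∑ b, W.outKernel a s b * Real.logb 2 (W.outKernel a s b / T.prob q b)) := by
  refine if_pos fun b hb => ?_
  by_contra hne
  exact (H.prob_pos hqs ((W.outKernel_nonneg a s b).lt_of_ne' hne)).ne' hb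

theorem sum_outKernel_mul_logb_nonneg (H : T.IsPotential W Ok h A B) {q : Q} {s : X} (hqs : Ok q s)
    (a : X) : 0 ≤ ∑ b, W.outKernel a s b * Real.logb 2 (W.outKernel a s b / T.prob q b) := by
  have h1 : ∑ b, (W.outKernel a s b - T.prob q b)
      ≤ ∑ b, W.outKernel a s b * Real.log (W.outKernel a s b / T.prob q b) :=
    Finset.sum_le_sum fun b _ => sub_le_mul_log_div (W.outKernel_nonneg a s b)
      (T.prob_nonneg q b) (H.prob_pos hqs)
  rw [Finset.sum_sub_distrib, W.sum_outKernel, T.prob_sum, sub_self] at h1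
  simp_rw [Real.logb, ← mul_div_assoc, ← Finset.sum_div]
  exact div_nonneg h1 (Real.log_pos one_lt_two).le

variable [DecidableEq X] [Fintype Q] [DecidableEq Q]

theorem ok_of_jointLaw_pos (H : T.IsPotential W Ok h A B) (hW : W.StateIsInput) {q₀ : Q} {s₀ : X}
    (h₀ : Ok q₀ s₀) (x : ℕ → X) (t : ℕ) {q : Q} {s : X}
    (hpos : 0 < T.jointLaw W s₀ q₀ x t q s) : Ok q s := by
  induction t generalizing q s with
  | zero =>
    unfold jointLaw at hpos
    split_ifs at hpos with hc
    · rw [hc.1, hc.2]; exact h₀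
    · exact absurd hpos (lt_irrefl _)
  | succ t ih =>
    by_contra hno
    refine hpos.ne' ?_
    unfold jointLaw
    refine Finset.sum_eq_zero fun q' _ => Finset.sum_eq_zero fun s' _ =>
      Finset.sum_eq_zero fun y _ => ?_
    split_ifs with hq
    · rw [hW.kernel_eq]
      split_ifs with hs
      · rcases (T.jointLaw_nonneg W s₀ q₀ x t q' s').eq_or_lt with h1 | h1
        · rw [← h1, zero_mul]
        rcases (W.outKernel_nonneg (x t) s' y).eq_or_lt with h2 | h2
        · rw [← h2, mul_zero]
        · exact absurd (hq ▸ hs ▸ H.ok_next (ih h1) h2) hno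
      · exact mul_zero _
    · rfl

/-- The costs telescope: for every input sequence the total cost of `n` steps is `n B`, up to the
change of the expected potential. -/
theorem exists_sum_relEntropy_eq (H : T.IsPotential W Ok h A B) (hW : W.StateIsInput) {q₀ : Q}
    {s₀ : X} (h₀ : Ok q₀ s₀) (x : ℕ → X) (n : ℕ) :
    ∃ r ∈ Set.Icc (n * B + h q₀ - A) (n * B + h q₀),
      ∑ t ∈ Finset.range n, ∑ q, ∑ s, ENNReal.ofReal (T.jointLaw W s₀ q₀ x t q s)
        * relEntropy (W.outKernel (x t) s) (T.prob q) = ENNReal.ofReal r := by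
  set J := T.jointLaw W s₀ q₀ x with hJ
  set D : ℕ → Q → X → ℝ := fun t q s =>
    ∑ b, W.outKernel (x t) s b * Real.logb 2 (W.outKernel (x t) s b / T.prob q b) with hD
  have hJ0 : ∀ t q s, 0 ≤ J t q s := fun t q s => T.jointLaw_nonneg W s₀ q₀ x t q s
  have hok : ∀ t q s, 0 < J t q s → Ok q s := fun t q s => H.ok_of_jointLaw_pos hW h₀ x t
  have hJD : ∀ t q s, 0 ≤ J t q s * D t q s := by
    intro t q s
    rcases (hJ0 t q s).eq_or_lt with hj | hj
    · simp [← hj]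
    · exact mul_nonneg hj.le (H.sum_outKernel_mul_logb_nonneg (hok t q s hj) _)
  set E : ℕ → ℝ := fun t => ∑ q, ∑ s, J t q s * h q with hE
  have hEmem : ∀ t, E t ∈ Set.Icc 0 A := by
    intro t
    constructor
    · exact Finset.sum_nonneg fun q _ => Finset.sum_nonneg fun s _ =>
        mul_nonneg (hJ0 t q s) (H.nonneg q)
    · have h1 : ∑ q, ∑ s, J t q s * A = A := by
        simp_rw [← Finset.sum_mul]
        rw [hJ, T.sum_jointLaw, one_mul]
      rw [← h1]
      exact Finset.sum_le_sum fun q _ => Finset.sum_le_sum fun s _ =>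
        mul_le_mul_of_nonneg_left (H.le q) (hJ0 t q s)
  have hE0 : E 0 = h q₀ := by
    simp_rw [hE, hJ, jointLaw, ite_and]
    simp
  have step : ∀ t, ∑ q, ∑ s, J t q s * D t q s = B + E t - E (t + 1) := by
    intro t
    have h1 : E (t + 1) = ∑ q, ∑ s, J t q s * ∑ y, W.outKernel (x t) s y * h (T.next q y) :=
      T.sum_jointLaw_succ W s₀ q₀ x t h
    have h2 : ∀ q s, J t q s * D t q s
        + J t q s * ∑ y, W.outKernel (x t) s y * h (T.next q y) = J t q s * B + J t q s * h q := by
      intro q s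
      rcases (hJ0 t q s).eq_or_lt with hj | hj
      · simp [← hj]
      rw [← mul_add, ← mul_add, ← H.sum_eq (x t) (hok t q s hj), hD, ← Finset.sum_add_distrib]
      simp_rw [mul_add]
    have h3 : ∑ q, ∑ s, J t q s * B = B := by
      simp_rw [← Finset.sum_mul]
      rw [hJ, T.sum_jointLaw, one_mul]
    have h4 := Finset.sum_congr rfl fun q (_ : q ∈ Finset.univ) =>
      Finset.sum_congr rfl fun s (_ : s ∈ Finset.univ) => h2 q s
    simp_rw [Finset.sum_add_distrib] at h4
    rw [← h1, h3] at h4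
    linarith
  have total : ∑ t ∈ Finset.range n, ∑ q, ∑ s, J t q s * D t q s = n * B + h q₀ - E n := by
    simp_rw [step]
    clear_value E
    induction n with
    | zero => simp [hE0]
    | succ n ih => rw [Finset.sum_range_succ, ih]; push_cast; ring
  refine ⟨n * B + h q₀ - E n, ⟨by linarith [(hEmem n).2], by linarith [(hEmem n).1]⟩, ?_⟩
  rw [← total, ENNReal.ofReal_sum_of_nonneg fun t _ =>
    Finset.sum_nonneg fun q _ => Finset.sum_nonneg fun s _ => hJD t q s]
  refine Finset.sum_congr rfl fun t _ => ?_
  rw [ENNReal.ofReal_sum_of_nonneg fun q _ => Finset.sum_nonneg fun s _ => hJD t q s]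
  refine Finset.sum_congr rfl fun q _ => ?_
  rw [ENNReal.ofReal_sum_of_nonneg fun s _ => hJD t q s]
  refine Finset.sum_congr rfl fun s _ => ?_
  rw [ENNReal.ofReal_mul (hJ0 t q s)]
  rcases (hJ0 t q s).eq_or_lt with hj | hj
  · simp [← hj]
  · rw [H.relEntropy_eq (hok t q s hj)]

theorem tendsto_dualRate [Nonempty X] (H : T.IsPotential W Ok h A B) (hW : W.StateIsInput) {q₀ : Q}
    {s₀ : X} (h₀ : Ok q₀ s₀) :
    Tendsto (fun n => T.dualRate W s₀ q₀ n) atTop (𝓝 (ENNReal.ofReal B)) := by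
  have hlim : ∀ c, Tendsto (fun n : ℕ => ENNReal.ofReal ((n * B + c) / (n : ℝ))) atTop
      (𝓝 (ENNReal.ofReal B)) := fun c =>
    (ENNReal.continuous_ofReal.tendsto B).comp (tendsto_natCast_mul_add_div B c)
  have hdiv : ∀ (r : ℝ) {n : ℕ}, 0 < n → ENNReal.ofReal r / (n : ENNReal)
      = ENNReal.ofReal (r / n) := fun r n hn => by
    rw [ENNReal.ofReal_div_of_pos (by exact_mod_cast hn), ENNReal.ofReal_natCast]
  refine tendsto_of_tendsto_of_tendsto_of_le_of_le' (hlim (h q₀ - A)) (hlim (h q₀)) ?_ ?_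
  · filter_upwards [eventually_gt_atTop 0] with n hn
    obtain ⟨r, hr, hre⟩ := H.exists_sum_relEntropy_eq hW h₀ (fun _ => Classical.arbitrary X) n
    rw [← hdiv _ hn, dualRate]
    refine ENNReal.div_le_div_right (le_trans ?_ (le_iSup _ fun _ => Classical.arbitrary X)) _
    rw [hre]
    exact ENNReal.ofReal_le_ofReal (by linarith [hr.1])
  · filter_upwards [eventually_gt_atTop 0] with n hn
    rw [← hdiv _ hn, dualRate]
    refine ENNReal.div_le_div_right (iSup_le fun x => ?_) _
    obtain ⟨r, hr, hre⟩ := H.exists_sum_relEntropy_eq hW h₀ x n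
    rw [hre]
    exact ENNReal.ofReal_le_ofReal hr.2

end IsPotential

/-! ### Feedback laws whose output law is the test law -/

section Policy

variable {X Y Q : Type} [Fintype Y] [Fintype X]

/-- The node reached from `q` along the edges labelled `y`. -/
def nodeAfter (T : GraphTest Y Q) : (t : ℕ) → Q → (Fin t → Y) → Q
  | 0, q, _ => q
  | t + 1, q, y => T.nodeAfter t (T.next q (y 0)) (Fin.tail y)

/-- The feedback law that draws the next input from `π q s`, where `q` is the current node and `s`
the previous input, or the initial state when there is none. -/
def policyLaw (T : GraphTest Y Q) (π : Q → X → stdSimplex ℝ X) (q : Q) (s : X) :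
    FSC.FeedbackLaw X Y :=
  fun t x y => π (T.nodeAfter t q y) ((Fin.cons s x : Fin (t + 1) → X) (Fin.last t))

theorem policyLaw_after (T : GraphTest Y Q) (π : Q → X → stdSimplex ℝ X) (q : Q) (s a : X) (b : Y) :
    (T.policyLaw π q s).after a b = T.policyLaw π (T.next q b) a := rfl

theorem policyLaw_first (T : GraphTest Y Q) (π : Q → X → stdSimplex ℝ X) (q : Q) (s : X) :
    (T.policyLaw π q s).first = π q s := rfl

variable [DecidableEq X]

/-- If the posterior law of the state given the past outputs is a function `β` of the node, and `β`
and the policy `π` together produce the edge probabilities, then the output law is the test law. -/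
theorem sum_belief_mul_causalLaw (T : GraphTest Y Q) {W : FSC X Y X} (hW : W.StateIsInput)
    {π : Q → X → stdSimplex ℝ X} {β : Q → X → ℝ} (hβ : ∀ q, ∑ s, β q s = 1)
    (hβπ : ∀ q a b, ∑ s, β q s * ((π q s).1 a * W.outKernel a s b)
      = T.prob q b * β (T.next q b) a) (n : ℕ) (q : Q) (y : Fin n → Y) :
    ∑ s, β q s * ∑ x, FSC.causalLaw (T.policyLaw π q s) n x y * W.outLaw n s x y
      = T.pathLaw n q y := by
  induction n generalizing q with
  | zero => simp [FSC.causalLaw, hW.outLaw_zero, pathLaw, hβ]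
  | succ n ih =>
    obtain ⟨b, z, rfl⟩ : ∃ b z, y = Fin.cons b z := ⟨y 0, Fin.tail y, (Fin.cons_self_tail y).symm⟩
    set G : X → ℝ := fun a => ∑ x, FSC.causalLaw (T.policyLaw π (T.next q b) a) n x z
      * W.outLaw n a x z with hG
    have e : ∀ s, ∑ x, FSC.causalLaw (T.policyLaw π q s) (n + 1) x (Fin.cons b z)
          * W.outLaw (n + 1) s x (Fin.cons b z)
        = ∑ a, (π q s).1 a * W.outKernel a s b * G a := by
      intro s
      rw [Fin.sum_pi_succ]
      refine Finset.sum_congr rfl fun a _ => ?_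
      rw [hG, Finset.mul_sum]
      refine Finset.sum_congr rfl fun x _ => ?_
      rw [FSC.causalLaw_cons, hW.outLaw_cons, policyLaw_after, policyLaw_first]
      ring
    simp_rw [e, Finset.mul_sum]
    rw [Finset.sum_comm, pathLaw_cons, ← ih, Finset.mul_sum]
    refine Finset.sum_congr rfl fun a _ => ?_
    rw [← mul_assoc, ← hβπ, Finset.sum_mul]
    exact Finset.sum_congr rfl fun s _ => by ring

theorem IsPotential.tendsto_feedbackInfoRate {T : GraphTest Y Q} {W : FSC X Y X}
    {Ok : Q → X → Prop} {h : Q → ℝ} {A B : ℝ} (H : T.IsPotential W Ok h A B) (hW : W.StateIsInput)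
    {q : Q} {s : X} (hqs : Ok q s) (f : FSC.FeedbackLaw X Y)
    (hf : ∀ n y, ∑ x, FSC.causalLaw f n x y * W.outLaw n s x y = T.pathLaw n q y) :
    Tendsto (fun n => W.feedbackInfoRate n s) atTop (𝓝 B) := by
  have : Nonempty (FSC.FeedbackLaw X Y) := ⟨f⟩
  refine tendsto_of_tendsto_of_tendsto_of_le_of_le (tendsto_natCast_mul_add_div B (h q - A))
    (tendsto_natCast_mul_add_div B (h q)) (fun n => ?_) fun n => ?_
  · rw [FSC.feedbackInfoRate, ← one_div_mul_eq_div _ (_ + _)]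
    refine mul_le_mul_of_nonneg_left ?_ (one_div_nonneg.2 n.cast_nonneg)
    refine le_trans ?_ (le_ciSup (W.bddAbove_directedInfo n s) f)
    linarith [H.le_directedInfo hW hqs f (hf n)]
  · rw [FSC.feedbackInfoRate, ← one_div_mul_eq_div _ (_ + _)]
    exact mul_le_mul_of_nonneg_left (ciSup_le fun g => H.directedInfo_le hW hqs g)
      (one_div_nonneg.2 n.cast_nonneg)

theorem IsPotential.infoRate_le [Nonempty X] {T : GraphTest Y Q} {W : FSC X Y X}
    {Ok : Q → X → Prop} {h : Q → ℝ} {A B : ℝ} (H : T.IsPotential W Ok h A B) (hW : W.StateIsInput)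
    {q : Q} {s : X} (hqs : Ok q s) (n : ℕ) : W.infoRate n s ≤ (n * B + h q) / n := by
  rw [FSC.infoRate, ← one_div_mul_eq_div _ (_ + _)]
  exact mul_le_mul_of_nonneg_left (ciSup_le fun P => H.mutualInfo_le hW hqs P)
    (one_div_nonneg.2 n.cast_nonneg)

end Policy

end GraphTest

/-! ### The dicode erasure channel and its test distribution -/

theorem existsUnique_rpow_eq (ε : ℝ) (hε : ε ∈ Set.Icc (0 : ℝ) 1) :
    ∃! p : ℝ, p ∈ Set.Ioo (0 : ℝ) 1 ∧ p ^ ε = 2 * (1 - p) := by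
  have hcont : ContinuousOn (fun p : ℝ => p ^ ε - 2 * (1 - p)) (Set.Icc (1 / 4) 1) := by
    refine ContinuousOn.sub (ContinuousOn.rpow_const continuousOn_id fun p hp => Or.inl ?_)
      (by fun_prop)
    have := hp.1
    exact (show (0 : ℝ) < p by linarith).ne'
  have hle : ((1 / 4 : ℝ)) ^ ε ≤ 1 := Real.rpow_le_one (by norm_num) (by norm_num) hε.1
  obtain ⟨p, hp, hpe⟩ := intermediate_value_Icc (by norm_num) hcont
    (show (0 : ℝ) ∈ Set.Icc _ _ from ⟨by linarith, by simp⟩)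
  have hpe' : p ^ ε = 2 * (1 - p) := by linarith
  have hp1 : p ≠ 1 := by rintro rfl; simp at hpe'
  refine ⟨p, ⟨⟨by linarith [hp.1], hp.2.lt_of_ne hp1⟩, hpe'⟩, ?_⟩
  have mono : ∀ {a b : ℝ}, 0 < a → a < b → a ^ ε = 2 * (1 - a) → b ^ ε = 2 * (1 - b) → False := by
    intro a b ha hab h1 h2
    linarith [Real.rpow_le_rpow ha.le hab.le hε.1]
  rintro r ⟨hr, hre⟩
  rcases lt_trichotomy r p with h | h | h
  · exact (mono hr.1 h hre hpe').elim
  · exact h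
  · exact (mono (by linarith [hp.1]) h hpe' hre).elim

variable {ε p : ℝ} {hε : ε ∈ Set.Icc (0 : ℝ) 1}

theorem dicodeErasure_stateIsInput : (dicodeErasure ε hε).StateIsInput :=
  fun _ _ _ _ h => if_neg h

theorem dicodeErasure_outKernel_none (x s : Fin 2) :
    (dicodeErasure ε hε).outKernel x s none = ε := by
  simp [FSC.outKernel, dicodeErasure]

theorem dicodeErasure_outKernel_some (x s : Fin 2) (d : SignType) :
    (dicodeErasure ε hε).outKernel x s (some d)
      = if (d : ℤ) = ((x : ℕ) : ℤ) - ((s : ℕ) : ℤ) then 1 - ε else 0 := by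
  simp [FSC.outKernel, dicodeErasure]

/-- The permutation of the outputs that turns the channel law from the state `0` into the one from
the state `1`: it subtracts `1` modulo `3` from an unerased output. -/
def dicodeRelabel : Option SignType ≃ Option SignType where
  toFun y := y.map fun d => match d with
    | .zero => .neg
    | .pos => .zero
    | .neg => .pos
  invFun y := y.map fun d => match d with
    | .neg => .zero
    | .zero => .pos
    | .pos => .neg
  left_inv y := by rcases y with _ | _ | _ | _ <;> rfl
  right_inv y := by rcases y with _ | _ | _ | _ <;> rfl

theorem dicodeErasure_outKernel_relabel (x : Fin 2) (y : Option SignType) :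
    (dicodeErasure ε hε).outKernel x 1 (dicodeRelabel y)
      = (dicodeErasure ε hε).outKernel x 0 y := by
  rcases y with _ | _ | _ | _ <;> fin_cases x <;>
    simp [dicodeRelabel, dicodeErasure_outKernel_none, dicodeErasure_outKernel_some]

/-- The initial state only affects the first output, up to a relabelling. -/
theorem dicodeErasure_mutualInfo_one (n : ℕ) (P : stdSimplex ℝ (Fin n → Fin 2)) :
    (dicodeErasure ε hε).mutualInfo n 1 P = (dicodeErasure ε hε).mutualInfo n 0 P := by
  have hW := dicodeErasure_stateIsInput (hε := hε)
  unfold FSC.mutualInfo FSC.infoSum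
  rcases n with _ | n
  · simp_rw [hW.outLaw_zero]
  refine Finset.sum_congr rfl fun x _ => ?_
  rw [Fin.sum_pi_succ, Fin.sum_pi_succ, ← dicodeRelabel.sum_comp]
  have h : ∀ x b y, (dicodeErasure ε hε).outLaw (n + 1) 1 x (Fin.cons (dicodeRelabel b) y)
      = (dicodeErasure ε hε).outLaw (n + 1) 0 x (Fin.cons b y) := by
    intro x b y
    rw [← Fin.cons_self_tail x, hW.outLaw_cons, hW.outLaw_cons, dicodeErasure_outKernel_relabel]
  simp_rw [h]

theorem dicodeErasure_exists_tendsto_infoRate :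
    ∃ C : ℝ, ∀ s, Tendsto (fun n => (dicodeErasure ε hε).infoRate n s) atTop (𝓝 C) := by
  refine dicodeErasure_stateIsInput.exists_tendsto_infoRate fun n s s' => ?_
  have h : ∀ s : Fin 2, ⨆ P, (dicodeErasure ε hε).mutualInfo n s P
      = ⨆ P, (dicodeErasure ε hε).mutualInfo n 0 P := by
    intro s
    fin_cases s
    · rfl
    · exact congrArg iSup (funext (dicodeErasure_mutualInfo_one n))
  rw [h s, h s']

/-- A node of the test distribution and a state are consistent if the state is the one known at the
node, if any. -/
def DicodeConsistent (q : Fin 3) (s : Fin 2) : Prop :=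
  (q = 0 → s = 0) ∧ (q = 1 → s = 1)

/-- The logarithmic form of the equation `p ^ ε = 2 (1 - p)`. -/
theorem mul_logb_of_rpow_eq (hp : p ∈ Set.Ioo (0 : ℝ) 1) (h : p ^ ε = 2 * (1 - p)) :
    ε * Real.logb 2 p = 1 + Real.logb 2 (1 - p) := by
  have h1 : 0 < 1 - p := by linarith [hp.2]
  rw [← Real.logb_rpow_eq_mul_logb_of_pos hp.1, h, Real.logb_mul two_ne_zero h1.ne',
    Real.logb_self_eq_one one_lt_two]

theorem dicodeBound_eq (hp : p ∈ Set.Ioo (0 : ℝ) 1) (h : p ^ ε = 2 * (1 - p)) :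
    1 + ε * Real.logb 2 ((1 - p) / p) = -((1 - ε) * Real.logb 2 (1 - p)) := by
  have h1 : 0 < 1 - p := by linarith [hp.2]
  rw [Real.logb_div h1.ne' hp.1.ne', mul_sub, mul_logb_of_rpow_eq hp h]
  ring

theorem dicodeBound_nonneg (hε : ε ∈ Set.Icc (0 : ℝ) 1) (hp : p ∈ Set.Ioo (0 : ℝ) 1)
    (h : p ^ ε = 2 * (1 - p)) : 0 ≤ 1 + ε * Real.logb 2 ((1 - p) / p) := by
  rw [dicodeBound_eq hp h, neg_nonneg]
  exact mul_nonpos_of_nonneg_of_nonpos (by linarith [hε.2])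
    (Real.logb_nonpos one_lt_two (by linarith [hp.2]) (by linarith [hp.1]))

theorem mul_logb_div_mul_self (L c : ℝ) :
    L * Real.logb 2 (L / (c * L)) = -(L * Real.logb 2 c) := by
  rcases eq_or_ne L 0 with rfl | hL
  · simp
  rw [div_mul_cancel_right₀ hL, Real.logb_inv, mul_neg]

theorem dicodeTest_isPotential (hp : p ∈ Set.Ioo (0 : ℝ) 1) (h : p ^ ε = 2 * (1 - p)) :
    (dicodeTest ε p hε (Set.Ioo_subset_Icc_self hp)).IsPotential (dicodeErasure ε hε)
      DicodeConsistent (fun q => if q = 2 then -((1 - ε) * Real.logb 2 p) else 0)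
      (-((1 - ε) * Real.logb 2 p)) (1 + ε * Real.logb 2 ((1 - p) / p)) := by
  have hp0 := hp.1
  have hp1 : 0 < 1 - p := by linarith [hp.2]
  have hL : 0 ≤ 1 - ε := by linarith [hε.2]
  have hA : 0 ≤ -((1 - ε) * Real.logb 2 p) := by
    rw [neg_nonneg]
    exact mul_nonpos_of_nonneg_of_nonpos hL (Real.logb_nonpos one_lt_two hp0.le hp.2.le)
  constructor
  · intro q; split_ifs; exacts [hA, le_rfl]
  · intro q; split_ifs; exacts [le_rfl, hA]
  · intro q s a b hqs hV
    rcases b with _ | d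
    · rwa [dicodeErasure_outKernel_none] at hV
    rw [dicodeErasure_outKernel_some] at hV
    split_ifs at hV with hd
    · revert hqs hd
      fin_cases q <;> fin_cases s <;> fin_cases a <;> rcases d with _ | _ | _ <;>
        simp [DicodeConsistent, dicodeTest] <;> first | positivity | linarith
    · exact absurd hV (lt_irrefl _)
  · intro q s a b hqs hV
    rcases b with _ | d
    · simp [DicodeConsistent, dicodeTest]
    rw [dicodeErasure_outKernel_some] at hV
    split_ifs at hV with hd
    · revert hqs hd
      fin_cases q <;> fin_cases s <;> fin_cases a <;> rcases d with _ | _ | _ <;>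
        simp [DicodeConsistent, dicodeTest]
    · exact absurd hV (lt_irrefl _)
  · intro q s a hqs
    have hlog := mul_logb_of_rpow_eq hp h
    have e1 : (1 - ε) * Real.logb 2 ((1 - ε) / ((1 - ε) / 2)) = 1 - ε := by
      rw [show (1 - ε) / 2 = 2⁻¹ * (1 - ε) by ring, mul_logb_div_mul_self,
        Real.logb_inv, Real.logb_self_eq_one one_lt_two]
      ring
    have e2 := mul_logb_div_mul_self (1 - ε) (1 - p)
    have e3 : (1 - ε) * Real.logb 2 ((1 - ε) / (p * (1 - ε) / 2))
        = (1 - ε) - (1 - ε) * Real.logb 2 p := by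
      rw [show p * (1 - ε) / 2 = (p / 2) * (1 - ε) by ring, mul_logb_div_mul_self,
        Real.logb_div hp0.ne' two_ne_zero, Real.logb_self_eq_one one_lt_two]
      ring
    have e4 : ε * Real.logb 2 (ε / ε) = 0 := by
      simpa using mul_logb_div_mul_self ε 1
    rw [dicodeBound_eq hp h, Fintype.sum_option, SignType.univ_eq]
    revert hqs
    fin_cases q <;> fin_cases s <;> fin_cases a <;>
      simp [DicodeConsistent, dicodeTest, dicodeErasure_outKernel_none,
        dicodeErasure_outKernel_some, mul_add, e1, e2, e3, e4] <;>
      first | ring1 | linear_combination -(1 - ε) * hlog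

/-! ### The optimal feedback law -/

/-- The law on `{0, 1}` that differs from `s` with probability `r`. -/
noncomputable def flipLaw (r : ℝ) (hr : r ∈ Set.Icc (0 : ℝ) 1) (s : Fin 2) : stdSimplex ℝ (Fin 2) :=
  ⟨fun x => if x = s then 1 - r else r, by
    constructor
    · intro x
      dsimp only
      split_ifs
      exacts [sub_nonneg.2 hr.2, hr.1]
    · fin_cases s <;> simp⟩

/-- The optimal policy: when the state is known to the transmitter and the receiver the input is
uniform, and otherwise the previous input is changed with probability `p`. -/
noncomputable def dicodePolicy (p : ℝ) (hp : p ∈ Set.Icc (0 : ℝ) 1) (q : Fin 3) (s : Fin 2) :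
    stdSimplex ℝ (Fin 2) :=
  if q = 2 then flipLaw p hp s else flipLaw (1 / 2) ⟨by norm_num, by norm_num⟩ s

/-- The posterior law of the state at each node under the optimal policy. -/
noncomputable def dicodeBelief (q : Fin 3) (s : Fin 2) : ℝ :=
  if q = 2 then 1 / 2 else if (q : ℕ) = s then 1 else 0

/-- Started at the node that records the state, the optimal policy has the test law as output
law. -/
theorem dicode_causalLaw_output (hp : p ∈ Set.Ioo (0 : ℝ) 1) (s : Fin 2) (n : ℕ)
    (y : Fin n → Option SignType) :
    ∑ x, FSC.causalLaw ((dicodeTest ε p hε (Set.Ioo_subset_Icc_self hp)).policyLaw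
        (dicodePolicy p (Set.Ioo_subset_Icc_self hp)) s.castSucc s) n x y
        * (dicodeErasure ε hε).outLaw n s x y
      = (dicodeTest ε p hε (Set.Ioo_subset_Icc_self hp)).pathLaw n s.castSucc y := by
  rw [← (dicodeTest ε p hε (Set.Ioo_subset_Icc_self hp)).sum_belief_mul_causalLaw
    (dicodeErasure_stateIsInput (hε := hε)) (π := dicodePolicy p (Set.Ioo_subset_Icc_self hp))
    (β := dicodeBelief) ?_ ?_ n s.castSucc y]
  · fin_cases s <;> simp [dicodeBelief]
  · intro q
    rw [Fin.sum_univ_two]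
    fin_cases q <;> simp [dicodeBelief] <;> norm_num
  · intro q a b
    rcases b with _ | _ | _ | _ <;> fin_cases q <;> fin_cases a <;>
      simp [dicodeBelief, dicodePolicy, flipLaw, dicodeTest, dicodeErasure_outKernel_none,
        dicodeErasure_outKernel_some] <;> ring

/-! ### The capacities of the dicode erasure channel -/

theorem theorem7 (ε : ℝ) (hε : ε ∈ Set.Icc (0 : ℝ) 1) :
    -- the equation for `p` has exactly one solution in `(0, 1)`
    (∃! p : ℝ, p ∈ Set.Ioo (0 : ℝ) 1 ∧ p ^ ε = 2 * (1 - p)) ∧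
    ∀ (p : ℝ) (hp : p ∈ Set.Ioo (0 : ℝ) 1), p ^ ε = 2 * (1 - p) →
      -- the capacity bound, for the operational capacity
      (∀ s0 : Fin 2, (dicodeErasure ε hε).capacity s0
          ≤ ((1 + ε * Real.logb 2 ((1 - p) / p) : ℝ) : EReal)) ∧
      -- the capacity bound, for the limit of the maximal mutual information rates
      (∃ C : ℝ, (∀ s0 : Fin 2,
            Tendsto (fun n : ℕ => (dicodeErasure ε hε).infoRate n s0) atTop (𝓝 C)) ∧
          C ≤ 1 + ε * Real.logb 2 ((1 - p) / p)) ∧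
      -- the bound is the value of the dual bound of the three-node test distribution, from any
      -- initial node that is consistent with the initial state
      (∀ (s0 : Fin 2) (q0 : Fin 3), (q0 = 0 → s0 = 0) → (q0 = 1 → s0 = 1) →
        Tendsto (fun n : ℕ =>
            (dicodeTest ε p hε (Set.Ioo_subset_Icc_self hp)).dualRate (dicodeErasure ε hε) s0 q0 n)
          atTop (𝓝 (ENNReal.ofReal (1 + ε * Real.logb 2 ((1 - p) / p))))) ∧
      -- the bound is the feedback capacity
      (∀ s0 : Fin 2,
        Tendsto (fun n : ℕ => (dicodeErasure ε hε).feedbackInfoRate n s0) atTop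
          (𝓝 (1 + ε * Real.logb 2 ((1 - p) / p)))) := by
  refine ⟨existsUnique_rpow_eq ε hε, fun p hp h => ?_⟩
  have H := dicodeTest_isPotential (hε := hε) hp h
  have hW := dicodeErasure_stateIsInput (hε := hε)
  have hqs : ∀ s : Fin 2, DicodeConsistent s.castSucc s := by
    intro s
    fin_cases s <;> simp [DicodeConsistent]
  refine ⟨fun s => H.capacity_le hW (dicodeBound_nonneg hε hp h) (hqs s), ?_,
    fun s q h0 h1 => H.tendsto_dualRate hW ⟨h0, h1⟩,
    fun s => H.tendsto_feedbackInfoRate hW (hqs s) _ (dicode_causalLaw_output hp s)⟩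
  obtain ⟨C, hC⟩ := dicodeErasure_exists_tendsto_infoRate (hε := hε)
  exact ⟨C, hC, le_of_tendsto_of_tendsto' (hC 0) (tendsto_natCast_mul_add_div _ _)
    fun n => H.infoRate_le hW (hqs 0) n⟩
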